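/- Conventions. For functions $f,g\colon\mathbb N\to\mathbb R_{\ge 0}$ write $f\preccurlyeq g$ if there is an integer $C>0$ with $f(n)\le C\,g(Cn+C)+Cn+C$ for all $n$, and $f\asymp g$ if $f\preccurlyeq g\preccurlyeq f$. A function $f$ is superadditive if $f(m+n)\ge f(m)+f(n)$ for all integers $m,n>0$; its superadditive closure $\overline f$ is the smallest superadditive function on the positive integers with $\overline f\ge f$ (and $\overline f(0):=0$). The area of a word $w$ representing $1$ in a finitely presented group $G=\langle X\mid R\rangle$ is the least $l$ such that $w=\prod_{i=1}^{l}u_ir_iu_i^{-1}$ in the free group $F(X)$ with $u_i\in F(X)$, $r_i\in R^{\pm1}$; the Dehn function $\delta_G(n)$ is the maximal area of a word of length at most $n$ in $X^{\pm 1}$ representing $1$; up to $\asymp$ it does not depend on the finite presentation. Given subgroups $A,B\le\mathbb Z^m$ with $\mathbb Z^m=A\oplus B$, a surjective homomorphism $\phi\colon G\to\mathbb Z^m$ is said to $\{A,B\}$-split if there are homomorphisms $s^1\colon A\to G$ and $s^2\colon B\to G$ with $\phi\circ s^1=\mathrm{id}_A$ and $\phi\circ s^2=\mathrm{id}_B$.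 Theorem. Let $m\ge 0$, let $G_1,\dots,G_4$ be finitely presented groups and let $\phi_i\colon G_i\to\mathbb Z^m$ ($1\le i\le 4$) be surjective homomorphisms. Suppose that there are subgroups $A,B\le\mathbb Z^m$ with $\mathbb Z^m=A\oplus B$ such that each $\phi_i$ $\{A,B\}$-splits. Let $\phi\colon G_1\times G_2\times G_3\times G_4\to\mathbb Z^m$ be defined by $\phi(g_1,g_2,g_3,g_4)=\sum_{i=1}^4\phi_i(g_i)$ and let $K=\ker\phi$. Then $K$ is finitely presented. Moreover, let $f\colon\mathbb N\to\mathbb R_{\ge0}$ be a Dehn function of $G_1\times G_2\times G_3\times G_4$, i.e. the Dehn function of some finite presentation of this group or, more generally, any non-decreasing function that is $\asymp$-equivalent to it, and let $\delta_K$ be the Dehn function of any finite presentation of $K$. Then $$f(n)\preccurlyeq\delta_K(n)\preccurlyeq\overline f(n)\cdot\log(n).$$ If, moreover, $n\mapsto f(n)/n$ is superadditive, then $f(n)\asymp\delta_K(n)$. -/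

import Mathlib

/-- A finite presentation `⟨x₁, …, x_k ∣ rels⟩` of the group `G`: the map `π` sends the free
generators to a generating family of `G`, and the finite set `rels` normally generates its kernel. -/
structure FinitePresentation (G : Type*) [Group G] where
  numGens : ℕ
  π : FreeGroup (Fin numGens) →* G
  surjective : Function.Surjective π
  rels : Set (FreeGroup (Fin numGens))
  finite_rels : rels.Finite
  normalClosure_rels : Subgroup.normalClosure rels = π.ker

namespace FinitePresentation

variable {G : Type*} [Group G] (P : FinitePresentation G)

/-- The conjugates `u r u⁻¹` with `r ∈ R^{±1}`. -/
def relConjugates : Set (FreeGroup (Fin P.numGens)) :=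
  {g | ∃ u r, (r ∈ P.rels ∨ r⁻¹ ∈ P.rels) ∧ g = u * r * u⁻¹}

/-- The area of `w`: the least number of factors in an expression of `w` as a product of conjugates
of relators and inverse relators. Only meaningful if `w` represents `1`; see `area_spec`. -/
noncomputable def area (w : FreeGroup (Fin P.numGens)) : ℕ :=
  sInf {l | ∃ L : List (FreeGroup (Fin P.numGens)),
    L.length = l ∧ (∀ g ∈ L, g ∈ P.relConjugates) ∧ L.prod = w}

/-- The areas of the (not necessarily reduced) words of length at most `n` that represent `1`. -/
def areas (n : ℕ) : Set ℕ :=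
  {a | ∃ w : List (Fin P.numGens × Bool),
    w.length ≤ n ∧ P.π (FreeGroup.mk w) = 1 ∧ P.area (FreeGroup.mk w) = a}

/-- The Dehn function of the presentation; the supremum is a maximum by `dehn_isGreatest`. -/
noncomputable def dehn (n : ℕ) : ℕ := sSup (P.areas n)

/-- For `w` representing `1` the minimum defining the area is taken over a non-empty set, hence
attained. -/
theorem area_spec (w : FreeGroup (Fin P.numGens)) (hw : P.π w = 1) :
    ∃ L : List (FreeGroup (Fin P.numGens)),
      L.length = P.area w ∧ (∀ g ∈ L, g ∈ P.relConjugates) ∧ L.prod = w := by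
  have hmem : w ∈ Subgroup.normalClosure P.rels := by
    rw [P.normalClosure_rels]; exact hw
  have hne : ∃ L : List (FreeGroup (Fin P.numGens)),
      (∀ g ∈ L, g ∈ P.relConjugates) ∧ L.prod = w := by
    unfold Subgroup.normalClosure at hmem
    induction hmem using Subgroup.closure_induction with
    | mem x hx =>
      obtain ⟨r, hr, hc⟩ := Group.mem_conjugatesOfSet_iff.1 hx
      obtain ⟨u, hu⟩ := isConj_iff.1 hc
      exact ⟨[x], by simpa using ⟨u, r, Or.inl hr, hu.symm⟩, by simp⟩
    | one => exact ⟨[], by simp, by simp⟩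
    | mul x y hx hy ihx ihy =>
      obtain ⟨L, hL, rfl⟩ := ihx (by
        have : x ∈ Subgroup.normalClosure P.rels := hx
        rw [P.normalClosure_rels] at this; exact this)
      obtain ⟨M, hM, rfl⟩ := ihy (by
        have : y ∈ Subgroup.normalClosure P.rels := hy
        rw [P.normalClosure_rels] at this; exact this)
      refine ⟨L ++ M, ?_, by simp⟩
      intro g hg
      rcases List.mem_append.1 hg with h | h
      · exact hL g h
      · exact hM g h
    | inv x hx ihx =>
      obtain ⟨L, hL, rfl⟩ := ihx (by
        have : x ∈ Subgroup.normalClosure P.rels := hx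
        rw [P.normalClosure_rels] at this; exact this)
      refine ⟨(L.map (·⁻¹)).reverse, ?_, (List.prod_inv_reverse L).symm⟩
      intro g hg
      simp only [List.mem_reverse, List.mem_map] at hg
      obtain ⟨h, hh, rfl⟩ := hg
      obtain ⟨u, r, hr, rfl⟩ := hL h hh
      exact ⟨u, r⁻¹, by rw [inv_inv]; exact hr.symm, by group⟩
  obtain ⟨L, hL, hp⟩ := hne
  exact Nat.sInf_mem (s := {l | ∃ L : List (FreeGroup (Fin P.numGens)),
    L.length = l ∧ (∀ g ∈ L, g ∈ P.relConjugates) ∧ L.prod = w}) ⟨L.length, L, rfl, hL, hp⟩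

theorem finite_areas (n : ℕ) : (P.areas n).Finite := by
  refine ((List.finite_length_le (Fin P.numGens × Bool) n).image
    fun w => P.area (FreeGroup.mk w)).subset ?_
  rintro a ⟨w, hw, -, rfl⟩
  exact ⟨w, hw, rfl⟩

theorem dehn_isGreatest (n : ℕ) : IsGreatest (P.areas n) (P.dehn n) :=
  ⟨Nat.sSup_mem ⟨_, [], by simp, map_one _, rfl⟩ (P.finite_areas n).bddAbove,
    fun _ ha => le_csSup (P.finite_areas n).bddAbove ha⟩

theorem dehn_mono : Monotone P.dehn := by
  intro m n h
  obtain ⟨w, hw, h1, h2⟩ := (P.dehn_isGreatest m).1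
  exact (P.dehn_isGreatest n).2 ⟨w, hw.trans h, h1, h2⟩

end FinitePresentation

/-- `f ≼ g`: there is a constant `C > 0` with `f(n) ≤ C g(C n + C) + C n + C` for all `n`. (For
non-decreasing non-negative functions, integral and real constants give the same relation.) -/
def AsympLE (f g : ℕ → ℝ) : Prop :=
  ∃ C : ℕ, 0 < C ∧ ∀ n : ℕ, f n ≤ C * g (C * n + C) + C * n + C

/-- `f ≍ g`: asymptotic equivalence. -/
def AsympEq (f g : ℕ → ℝ) : Prop := AsympLE f g ∧ AsympLE g f

theorem AsympEq.refl_of_monotone {f : ℕ → ℝ} (hf : Monotone f) : AsympEq f f := by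
  have h : AsympLE f f := ⟨1, one_pos, fun n => by
    have h1 : f n ≤ f (1 * n + 1) := hf (by omega)
    have h2 : (0 : ℝ) ≤ n := n.cast_nonneg
    push_cast; linarith⟩
  exact ⟨h, h⟩

/-- Superadditivity of a function on the positive integers. -/
def IsSuperadditive (f : ℕ → ℝ) : Prop :=
  ∀ m n : ℕ, 0 < m → 0 < n → f m + f n ≤ f (m + n)

/-- The superadditive closure: `n` is mapped to the maximum of `f(n₁) + ⋯ + f(n_k)` over all
`n = n₁ + ⋯ + n_k` with `nᵢ ≥ 1`. By the three theorems below it is the smallest superadditive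
function on the positive integers that is bounded below by `f`. -/
noncomputable def superadditiveClosure (f : ℕ → ℝ) (n : ℕ) : ℝ :=
  ⨆ c : Composition n, (c.blocks.map f).sum

theorem le_superadditiveClosure (f : ℕ → ℝ) {n : ℕ} (hn : 0 < n) :
    f n ≤ superadditiveClosure f n := by
  have h := le_ciSup (Set.finite_range fun c : Composition n => (c.blocks.map f).sum).bddAbove
    (Composition.single n hn)
  simpa [superadditiveClosure, Composition.single_blocks] using h

theorem isSuperadditive_superadditiveClosure (f : ℕ → ℝ) :
    IsSuperadditive (superadditiveClosure f) := by
  intro m n _ _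
  obtain ⟨c, hc⟩ := exists_eq_ciSup_of_finite (f := fun c : Composition m => (c.blocks.map f).sum)
  obtain ⟨d, hd⟩ := exists_eq_ciSup_of_finite (f := fun c : Composition n => (c.blocks.map f).sum)
  unfold superadditiveClosure
  rw [← hc, ← hd]
  have h := le_ciSup
    (Set.finite_range fun c : Composition (m + n) => (c.blocks.map f).sum).bddAbove (c.append d)
  simpa [Composition.append] using h

theorem superadditiveClosure_le {f g : ℕ → ℝ} (hg : IsSuperadditive g)
    (hfg : ∀ n, 0 < n → f n ≤ g n) {n : ℕ} (hn : 0 < n) : superadditiveClosure f n ≤ g n := by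
  have key : ∀ L : List ℕ, (∀ i ∈ L, 0 < i) → L ≠ [] → (L.map f).sum ≤ g L.sum := by
    intro L
    induction L with
    | nil => intro _ h; exact absurd rfl h
    | cons a L ih =>
      intro hpos _
      have ha : 0 < a := hpos a (by simp)
      by_cases hL : L = []
      · subst hL; simpa using hfg a ha
      · have h1 := ih (fun i hi => hpos i (by simp [hi])) hL
        have h2 : 0 < L.sum := by
          obtain ⟨b, M, rfl⟩ := List.exists_cons_of_ne_nil hL
          have hb := hpos b (by simp)
          simp only [List.sum_cons]; omega
        have h3 := hg a L.sum ha h2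
        have h4 := hfg a ha
        simp only [List.map_cons, List.sum_cons]
        linarith
  refine ciSup_le fun c => ?_
  have h := key c.blocks (fun i hi => c.blocks_pos hi) (by
    intro h0
    have := c.blocks_sum
    rw [h0] at this
    simp at this
    omega)
  rwa [c.blocks_sum] at h

/-- The surjection `φ : G → ℤᵐ` (written multiplicatively) splits with respect to the pair
`{A, B}` of subgroups of `ℤᵐ`: there are homomorphisms `A → G` and `B → G` which are right inverse
to `φ` over `A` and `B`. -/
def PSplits {G : Type*} [Group G] {m : ℕ} (φ : G →* Multiplicative (Fin m → ℤ))
    (A B : AddSubgroup (Fin m → ℤ)) : Prop :=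
  (∃ s : Multiplicative A →* G,
      ∀ a : A, φ (s (Multiplicative.ofAdd a)) = Multiplicative.ofAdd (a : Fin m → ℤ)) ∧
  (∃ s : Multiplicative B →* G,
      ∀ b : B, φ (s (Multiplicative.ofAdd b)) = Multiplicative.ofAdd (b : Fin m → ℤ))

/-- The homomorphism `(g₁, g₂, g₃, g₄) ↦ ∑ φᵢ(gᵢ)` from the direct product to `ℤᵐ`
(written multiplicatively). -/
def sumHom {G : Fin 4 → Type*} [∀ i, Group (G i)] {m : ℕ}
    (φ : ∀ i, G i →* Multiplicative (Fin m → ℤ)) :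
    (∀ i, G i) →* Multiplicative (Fin m → ℤ) where
  toFun g := Multiplicative.ofAdd (∑ i, (φ i (g i)).toAdd)
  map_one' := by simp
  map_mul' g h := by simp [Finset.sum_add_distrib]

/-! Let `H n` be `n ^ 2` plus the Dehn functions of the four factors. For every factor `i` and two
further coordinates `j`, `k` there is a homomorphism `twist i j k` from `G i` to the kernel `K`
which keeps `x` in coordinate `i` and corrects its `A`-part in coordinate `j` and its `B`-part in
coordinate `k`. Four of these twists generate `K` and give a normal form `ω` (`eq_prod_twist`). Two
twists of the same factor differ by a twist of a section value, and twists of two factors with the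
same two correction coordinates commute, which takes four distinct coordinates.

Filling estimates become exact algebra as follows. Consider families of elements of linearly bounded
word length, and families of words over generators of `K` modulo those of area at most `C * H (C *
(n + 1))`. A homomorphism to `K` from a group with Dehn function dominated by `H` induces a
homomorphism between these groups of families (`familyHom`). Commuting homomorphisms induce
commuting ones (`familyHom_commute`), because forming a direct product costs only a further
quadratic term. Hence identities between twists lift to words up to negligible area, and the
group-theoretic computations `conj_of_swap` and `normalForm_mul` show that triangles `ω g * ω h * (ω
(g * h))⁻¹` have area dominated by `H`.

Bisecting a word of length `2 ^ j` reduces it to `2 ^ (j - 1 - i)` triangles of scale `2 ^ i` for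
each `i < j`, together with linearly many letters. By superadditivity each scale contributes at most
a multiple of the closure of `f`, and the number of scales gives the logarithm. If `f n / n` is
superadditive, then `f (2 * n) ≥ 4 * f n`, so the sum over the scales is geometric and the logarithm
disappears.

For the lower bound, each factor is a retract of `K`, and the Dehn function of the product is at
most of the order of `H`. The square in `H` is accounted for, when `m ≠ 0`, by a copy of `ℤ²` in `K`
detected by characters: lifting the characters to the Heisenberg group gives a quadratic lower bound
(`exists_sq_le_dehn`). -/

/-! ### Calculus of areas in an arbitrary group -/

section Area

variable {F F' : Type*} [Group F] [Group F']

/-- `w` is a product of at most `c` conjugates of elements of `R` and their inverses. -/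
def AreaLE (R : Set F) (c : ℕ) (w : F) : Prop :=
  ∃ L : List F, L.length ≤ c ∧ (∀ g ∈ L, ∃ u r, (r ∈ R ∨ r⁻¹ ∈ R) ∧ g = u * r * u⁻¹) ∧ L.prod = w

theorem AreaLE.one (R : Set F) (c : ℕ) : AreaLE R c 1 := ⟨[], by simp, by simp, by simp⟩

theorem AreaLE.mono {R S : Set F} {c d : ℕ} {w : F} (h : AreaLE R c w) (hRS : R ⊆ S)
    (hcd : c ≤ d) : AreaLE S d w := by
  obtain ⟨L, h1, h2, h3⟩ := h
  refine ⟨L, h1.trans hcd, fun g hg => ?_, h3⟩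
  obtain ⟨u, r, hr, rfl⟩ := h2 g hg
  exact ⟨u, r, hr.imp (fun h => hRS h) (fun h => hRS h), rfl⟩

theorem AreaLE.mono_right {R : Set F} {c d : ℕ} {w : F} (h : AreaLE R c w) (hcd : c ≤ d) :
    AreaLE R d w := h.mono subset_rfl hcd

theorem AreaLE.of_mem {R : Set F} {w : F} (h : w ∈ R) : AreaLE R 1 w :=
  ⟨[w], by simp, by simpa using ⟨1, w, Or.inl h, by simp⟩, by simp⟩

theorem AreaLE.mul {R : Set F} {c d : ℕ} {v w : F} (hv : AreaLE R c v) (hw : AreaLE R d w) :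
    AreaLE R (c + d) (v * w) := by
  obtain ⟨L, h1, h2, rfl⟩ := hv
  obtain ⟨M, k1, k2, rfl⟩ := hw
  refine ⟨L ++ M, by simp; omega, fun g hg => ?_, by simp⟩
  rcases List.mem_append.1 hg with h | h
  · exact h2 g h
  · exact k2 g h

theorem AreaLE.inv {R : Set F} {c : ℕ} {w : F} (hw : AreaLE R c w) : AreaLE R c w⁻¹ := by
  obtain ⟨L, h1, h2, rfl⟩ := hw
  refine ⟨(L.map (·⁻¹)).reverse, by simpa using h1, ?_, (List.prod_inv_reverse L).symm⟩
  intro g hg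
  simp only [List.mem_reverse, List.mem_map] at hg
  obtain ⟨h, hh, rfl⟩ := hg
  obtain ⟨u, r, hr, rfl⟩ := h2 h hh
  exact ⟨u, r⁻¹, by rw [inv_inv]; exact hr.symm, by group⟩

/-- All conjugates appear in the hypothesis because conjugation invariance, `AreaLE.conj`, is itself
deduced from this lemma; `AreaLE.map` is the convenient form. -/
theorem AreaLE.map_of_forall {R : Set F} {S : Set F'} {c d : ℕ} {w : F} (f : F →* F')
    (hw : AreaLE R c w) (hR : ∀ r ∈ R, ∀ u : F', AreaLE S d (u * f r * u⁻¹)) :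
    AreaLE S (c * d) (f w) := by
  obtain ⟨L, h1, h2, rfl⟩ := hw
  have key : ∀ L : List F, (∀ g ∈ L, ∃ u r, (r ∈ R ∨ r⁻¹ ∈ R) ∧ g = u * r * u⁻¹) →
      AreaLE S (L.length * d) (f L.prod) := by
    intro L
    induction L with
    | nil => intro _; simpa using AreaLE.one S _
    | cons a L ih =>
      intro h
      have hL := ih fun g hg => h g (by simp [hg])
      obtain ⟨u, r, hr, rfl⟩ := h a (by simp)
      have ha : AreaLE S d (f (u * r * u⁻¹)) := by
        rcases hr with hr | hr
        · simpa using hR r hr (f u)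
        · have := (hR _ hr (f u)).inv
          simpa [mul_assoc] using this
      have := ha.mul hL
      rw [List.prod_cons, map_mul]
      exact this.mono_right (by simp [add_mul, add_comm])
  exact (key L h2).mono_right (Nat.mul_le_mul_right _ h1)

theorem AreaLE.conj {R : Set F} {c : ℕ} {w : F} (hw : AreaLE R c w) (u : F) :
    AreaLE R c (u * w * u⁻¹) := by
  have := hw.map_of_forall (S := R) (d := 1) (MulAut.conj u).toMonoidHom (fun r hr v =>
    ⟨[v * (u * r * u⁻¹) * v⁻¹], by simp, by
      simpa using ⟨v * u, r, Or.inl hr, by group⟩, by simp⟩)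
  simpa using this

theorem AreaLE.map {R : Set F} {S : Set F'} {c d : ℕ} {w : F} (f : F →* F')
    (hw : AreaLE R c w) (hR : ∀ r ∈ R, AreaLE S d (f r)) : AreaLE S (c * d) (f w) :=
  hw.map_of_forall f fun r hr u => (hR r hr).conj u

theorem AreaLE.mem_normalClosure {R : Set F} {c : ℕ} {w : F} (hw : AreaLE R c w) :
    w ∈ Subgroup.normalClosure R := by
  obtain ⟨L, -, h2, rfl⟩ := hw
  refine Subgroup.list_prod_mem _ fun g hg => ?_
  obtain ⟨u, r, hr, rfl⟩ := h2 g hg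
  refine Subgroup.normalClosure_normal.conj_mem _ ?_ u
  rcases hr with hr | hr
  · exact Subgroup.subset_normalClosure hr
  · exact inv_mem_iff.1 (Subgroup.subset_normalClosure hr)

/-- `u` and `v` differ by at most `c` conjugates of relators. -/
def Close (R : Set F) (c : ℕ) (u v : F) : Prop := AreaLE R c (u * v⁻¹)

theorem Close.refl (R : Set F) (c : ℕ) (u : F) : Close R c u u := by
  simpa [Close] using AreaLE.one R c

theorem Close.mono {R S : Set F} {c d : ℕ} {u v : F} (h : Close R c u v) (hRS : R ⊆ S)
    (hcd : c ≤ d) : Close S d u v := AreaLE.mono h hRS hcd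

theorem Close.mono_right {R : Set F} {c d : ℕ} {u v : F} (h : Close R c u v) (hcd : c ≤ d) :
    Close R d u v := AreaLE.mono_right h hcd

theorem Close.symm {R : Set F} {c : ℕ} {u v : F} (h : Close R c u v) : Close R c v u := by
  have := AreaLE.inv h
  simpa [Close] using this

theorem Close.trans {R : Set F} {c d : ℕ} {u v w : F} (h : Close R c u v) (h' : Close R d v w) :
    Close R (c + d) u w := by
  have := AreaLE.mul h h'
  simpa [Close] using this

theorem Close.mul {R : Set F} {c d : ℕ} {u v u' v' : F} (h : Close R c u v)
    (h' : Close R d u' v') : Close R (c + d) (u * u') (v * v') := by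
  have := (AreaLE.conj h' u).mul h
  rw [add_comm]
  unfold Close
  convert this using 1
  group

theorem Close.inv {R : Set F} {c : ℕ} {u v : F} (h : Close R c u v) : Close R c u⁻¹ v⁻¹ := by
  have := (AreaLE.conj h.symm u⁻¹)
  unfold Close
  convert this using 1
  group

theorem Close.mul_left {R : Set F} {d : ℕ} {u' v' : F} (u : F)
    (h' : Close R d u' v') : Close R d (u * u') (u * v') := by
  simpa using (Close.refl R 0 u).mul h'

theorem Close.mul_right {R : Set F} {d : ℕ} {u' v' : F}
    (h' : Close R d u' v') (u : F) : Close R d (u' * u) (v' * u) := by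
  simpa using h'.mul (Close.refl R 0 u)

theorem Close.areaLE {R : Set F} {c d : ℕ} {u v : F} (h : Close R c u v) (hv : AreaLE R d v) :
    AreaLE R (c + d) u := by
  have := AreaLE.mul h hv
  simpa using this

end Area

/-! ### Letter-by-letter comparison of homomorphisms on free groups -/

section Words

variable {X : Type*} {F : Type*} [Group F]

theorem FreeGroup.mk_cons_eq_mul (x : X) (b : Bool) (L : List (X × Bool)) :
    FreeGroup.mk ((x, b) :: L) = FreeGroup.mk [(x, b)] * FreeGroup.mk L := by
  rw [FreeGroup.mul_mk]; rfl

theorem FreeGroup.mk_singleton (x : X) (b : Bool) :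
    FreeGroup.mk [(x, b)] = if b then FreeGroup.of x else (FreeGroup.of x)⁻¹ := by
  cases b <;> rfl

theorem FreeGroup.exists_lift_of_surjective {G : Type*} [Group G] {π : F →* G}
    (hπ : Function.Surjective π) (θ : FreeGroup X →* G) :
    ∃ V : FreeGroup X →* F, ∀ w, π (V w) = θ w := by
  refine ⟨FreeGroup.lift fun x => Function.surjInv hπ (θ (FreeGroup.of x)), fun w => ?_⟩
  rw [← MonoidHom.comp_apply]
  congr 1
  ext x
  simp [Function.surjInv_eq]

variable [DecidableEq X]

/-- Word-wise induction with a linear bookkeeping parameter. -/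
theorem FreeGroup.norm_induction {p : ℕ → FreeGroup X → Prop} (w : FreeGroup X)
    (one : p 0 1) (mul : ∀ x n w, p n w → p (n + 1) (FreeGroup.of x * w))
    (inv_mul : ∀ x n w, p n w → p (n + 1) ((FreeGroup.of x)⁻¹ * w)) : p w.norm w := by
  have key : ∀ L : List (X × Bool), p L.length (FreeGroup.mk L) := by
    intro L
    induction L with
    | nil => exact one
    | cons a L ih =>
      obtain ⟨x, b⟩ := a
      rw [FreeGroup.mk_cons_eq_mul, FreeGroup.mk_singleton]
      cases b
      · exact inv_mul x _ _ ih
      · exact mul x _ _ ih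
  have := key w.toWord
  rwa [FreeGroup.mk_toWord] at this

theorem Close.lift {R : Set F} {d : ℕ} (f g : FreeGroup X →* F)
    (h : ∀ x, Close R d (f (FreeGroup.of x)) (g (FreeGroup.of x))) (w : FreeGroup X) :
    Close R (w.norm * d) (f w) (g w) := by
  refine FreeGroup.norm_induction (p := fun n w => Close R (n * d) (f w) (g w)) w ?_ ?_ ?_
  · simpa using Close.refl R _ 1
  · intro x n w hw
    rw [map_mul, map_mul]
    exact ((h x).mul hw).mono_right (by rw [add_mul]; omega)
  · intro x n w hw
    rw [map_mul, map_mul, map_inv, map_inv]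
    exact ((h x).inv.mul hw).mono_right (by rw [add_mul]; omega)

theorem Close.comm_of_generators {R : Set F} {d : ℕ} (f : FreeGroup X →* F) (z : F)
    (h : ∀ x, Close R d (f (FreeGroup.of x) * z) (z * f (FreeGroup.of x))) (w : FreeGroup X) :
    Close R (w.norm * d) (f w * z) (z * f w) := by
  have h' := Close.lift f ((MulAut.conj z).toMonoidHom.comp f) (R := R) (d := d) (fun x => by
    have := (h x).mul_right z⁻¹
    simpa [mul_assoc] using this) w
  simpa [mul_assoc] using h'.mul_right z

/-- A homomorphism that is letter-wise close to the product of two almost commuting homomorphisms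
is close to that product. -/
theorem Close.lift_mul {R : Set F} {d : ℕ} (f g h : FreeGroup X →* F)
    (hf : ∀ x, Close R d (f (FreeGroup.of x)) (g (FreeGroup.of x) * h (FreeGroup.of x)))
    (hc : ∀ x y, Close R d (g (FreeGroup.of x) * h (FreeGroup.of y))
      (h (FreeGroup.of y) * g (FreeGroup.of x))) (w : FreeGroup X) :
    Close R (w.norm * ((w.norm + 2) * d)) (f w) (g w * h w) := by
  have hletter : ∀ (x : X) (v : FreeGroup X),
      Close R (v.norm * d) (h (FreeGroup.of x) * g v) (g v * h (FreeGroup.of x)) := fun x v =>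
    (Close.comm_of_generators g _ (fun y => hc y x) v).symm
  have hletter' : ∀ (x : X) (v : FreeGroup X),
      Close R (v.norm * d) ((h (FreeGroup.of x))⁻¹ * g v) (g v * (h (FreeGroup.of x))⁻¹) :=
    fun x v => by
      have := ((hletter x v).mul_left (h (FreeGroup.of x))⁻¹).mul_right (h (FreeGroup.of x))⁻¹
      simpa [mul_assoc] using this.symm
  -- With the bound `N` fixed during the induction, each exchange of a letter with a prefix costs at
  -- most `N * d`. The induction parameter only bounds the norm of the current word, since products
  -- may cancel; hence the extra clause below.
  suffices H : ∀ N, w.norm ≤ N → Close R (w.norm * ((N + 2) * d)) (f w) (g w * h w) from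
    H _ le_rfl
  intro N hN
  suffices H : w.norm ≤ w.norm ∧ (w.norm ≤ N → Close R (w.norm * ((N + 2) * d)) (f w) (g w * h w))
    from H.2 hN
  refine FreeGroup.norm_induction
    (p := fun n w => w.norm ≤ n ∧ (n ≤ N → Close R (n * ((N + 2) * d)) (f w) (g w * h w)))
    w ?_ ?_ ?_
  · simpa using Close.refl R 0 1
  · rintro x n v ⟨h1, h2⟩
    refine ⟨(FreeGroup.norm_mul_le _ _).trans (by rw [FreeGroup.norm_of]; omega), fun hn => ?_⟩
    simp only [map_mul]
    have e1 := (hf x).mul (h2 (by omega))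
    have e2 := ((hletter x v).mul_left (g (FreeGroup.of x))).mul_right (h v)
    have e3 := e1.trans (by simpa [mul_assoc] using e2)
    simp only [mul_assoc] at e3 ⊢
    refine e3.mono_right ?_
    have : v.norm * d ≤ N * d := Nat.mul_le_mul_right _ (by omega)
    nlinarith
  · rintro x n v ⟨h1, h2⟩
    refine ⟨(FreeGroup.norm_mul_le _ _).trans
      (by rw [FreeGroup.norm_inv_eq, FreeGroup.norm_of]; omega), fun hn => ?_⟩
    simp only [map_mul, map_inv]
    have e0 : Close R (d + d) (f (FreeGroup.of x))⁻¹
        ((g (FreeGroup.of x))⁻¹ * (h (FreeGroup.of x))⁻¹) := by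
      have := ((hf x).trans (hc x x)).inv
      simpa using this
    have e1 := e0.mul (h2 (by omega))
    have e2 := ((hletter' x v).mul_left (g (FreeGroup.of x))⁻¹).mul_right (h v)
    have e3 := e1.trans (by simpa [mul_assoc] using e2)
    simp only [mul_assoc] at e3 ⊢
    refine e3.mono_right ?_
    have : v.norm * d ≤ N * d := Nat.mul_le_mul_right _ (by omega)
    nlinarith

theorem FreeGroup.exists_norm_map_le {X' : Type*} [DecidableEq X'] [Finite X]
    (f : FreeGroup X →* FreeGroup X') : ∃ M : ℕ, ∀ w, (f w).norm ≤ M * w.norm := by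
  obtain ⟨M, hM⟩ := (Set.finite_range fun x : X => (f (FreeGroup.of x)).norm).bddAbove
  have hM' : ∀ x, (f (FreeGroup.of x)).norm ≤ M := fun x => hM ⟨x, rfl⟩
  refine ⟨M, fun w => ?_⟩
  refine FreeGroup.norm_induction (p := fun n w => (f w).norm ≤ M * n) w (by simp) ?_ ?_
  · intro x n w hw
    rw [_root_.map_mul]
    exact (FreeGroup.norm_mul_le _ _).trans (by have := hM' x; rw [mul_add]; omega)
  · intro x n w hw
    rw [_root_.map_mul, _root_.map_inv]
    refine (FreeGroup.norm_mul_le _ _).trans ?_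
    rw [FreeGroup.norm_inv_eq]
    have := hM' x; rw [mul_add]; omega

end Words

/-! ### Dehn functions and retracts -/

namespace FinitePresentation

variable {G : Type*} [Group G] (P : FinitePresentation G)

theorem map_rels {r : FreeGroup (Fin P.numGens)} (hr : r ∈ P.rels) : P.π r = 1 := by
  have : r ∈ P.π.ker := by
    rw [← P.normalClosure_rels]; exact Subgroup.subset_normalClosure hr
  exact this

theorem areaLE_area {w : FreeGroup (Fin P.numGens)} (hw : P.π w = 1) :
    AreaLE P.rels (P.area w) w := by
  obtain ⟨L, h1, h2, h3⟩ := P.area_spec w hw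
  exact ⟨L, h1.le, h2, h3⟩

theorem areaLE_dehn {w : FreeGroup (Fin P.numGens)} (hw : P.π w = 1) {n : ℕ} (hn : w.norm ≤ n) :
    AreaLE P.rels (P.dehn n) w := by
  refine (P.areaLE_area hw).mono_right ((P.dehn_isGreatest n).2 ⟨w.toWord, hn, ?_, ?_⟩)
  · rwa [FreeGroup.mk_toWord]
  · rw [FreeGroup.mk_toWord]

theorem area_le {w : FreeGroup (Fin P.numGens)} {c : ℕ} (h : AreaLE P.rels c w) :
    P.area w ≤ c := by
  obtain ⟨L, h1, h2, h3⟩ := h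
  have hm : L.length ∈ {l | ∃ L : List (FreeGroup (Fin P.numGens)),
      L.length = l ∧ (∀ g ∈ L, g ∈ P.relConjugates) ∧ L.prod = w} := ⟨L, rfl, h2, h3⟩
  exact (Nat.sInf_le hm).trans h1

theorem dehn_le {n c : ℕ}
    (h : ∀ w : FreeGroup (Fin P.numGens), P.π w = 1 → w.norm ≤ n → AreaLE P.rels c w) :
    P.dehn n ≤ c := by
  obtain ⟨w, h1, h2, h3⟩ := (P.dehn_isGreatest n).1
  rw [← h3]
  exact P.area_le (h _ h2 (FreeGroup.norm_mk_le.trans h1))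

theorem exists_areaLE_of_finite {ι : Type*} [Finite ι] (r : ι → FreeGroup (Fin P.numGens))
    (hr : ∀ i, P.π (r i) = 1) : ∃ d, ∀ i, AreaLE P.rels d (r i) := by
  obtain ⟨M, hM⟩ := (Set.finite_range fun i => P.area (r i)).bddAbove
  exact ⟨M, fun i => (P.areaLE_area (hr i)).mono_right (hM ⟨i, rfl⟩)⟩

/-- A presentation obtained from a finite set of relators in which every relation has a filling. -/
def ofAreaLE {k : ℕ} (π : FreeGroup (Fin k) →* G) (hπ : Function.Surjective π)
    (R : Set (FreeGroup (Fin k))) (hR : R.Finite) (hR1 : ∀ r ∈ R, π r = 1)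
    (h : ∀ w, π w = 1 → ∃ c, AreaLE R c w) : FinitePresentation G where
  numGens := k
  π := π
  surjective := hπ
  rels := R
  finite_rels := hR
  normalClosure_rels := le_antisymm (Subgroup.normalClosure_le_normal hR1) fun w hw => by
    obtain ⟨c, hc⟩ := h w hw
    exact hc.mem_normalClosure

theorem isFinitelyPresented (P : FinitePresentation G) : Group.IsFinitelyPresented G :=
  ⟨P.numGens, P.π, P.surjective, P.rels, P.finite_rels, P.normalClosure_rels⟩

theorem nonempty_of_isFinitelyPresented (h : Group.IsFinitelyPresented G) :
    Nonempty (FinitePresentation G) := by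
  obtain ⟨n, π, h1, R, h2, h3⟩ := h
  exact ⟨⟨n, π, h1, R, h2, h3⟩⟩

/-- The Dehn function of a retract is dominated by the Dehn function of the group. -/
theorem exists_dehn_le_of_retract {G' : Type*} [Group G'] (P : FinitePresentation G)
    (P' : FinitePresentation G') (s : G →* G') (r : G' →* G) (hrs : ∀ g, r (s g) = g) :
    ∃ C : ℕ, ∀ n, P.dehn n ≤ C * P'.dehn (C * n) + C * n := by
  obtain ⟨S, hS⟩ := FreeGroup.exists_lift_of_surjective P'.surjective (s.comp P.π)
  obtain ⟨ρ, hρ⟩ := FreeGroup.exists_lift_of_surjective P.surjective (r.comp P'.π)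
  obtain ⟨M, hM⟩ := FreeGroup.exists_norm_map_le S
  obtain ⟨d₁, h₁⟩ := P.exists_areaLE_of_finite
    (fun x => FreeGroup.of x * (ρ (S (FreeGroup.of x)))⁻¹) (fun x => by simp [hρ, hS, hrs])
  have := P'.finite_rels.to_subtype
  obtain ⟨d₂, h₂⟩ := P.exists_areaLE_of_finite (fun x : P'.rels => ρ x)
    (fun x => by simp [hρ, P'.map_rels x.2])
  refine ⟨M + d₁ + d₂, fun n => P.dehn_le fun w hw hn => ?_⟩
  -- Going to `G'` and back alters each letter by a relation of bounded area, so the error is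
  -- linear; the filling of `S w` is then pushed forward by `ρ`.
  have e1 : Close P.rels (w.norm * d₁) w (ρ (S w)) :=
    Close.lift (MonoidHom.id _) (ρ.comp S) h₁ w
  have e2 : AreaLE P'.rels (P'.dehn ((M + d₁ + d₂) * n)) (S w) :=
    P'.areaLE_dehn (by simp [hS, hw]) ((hM w).trans (by gcongr; omega))
  have e3 := e2.map ρ (fun r hr => h₂ ⟨r, hr⟩)
  refine (e1.areaLE e3).mono_right ?_
  rw [add_comm, mul_comm _ d₂, mul_comm _ d₁]
  gcongr <;> omega

end FinitePresentation

/-! ### Dehn functions of direct products -/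

section Product

variable {G G' : Type*} [Group G] [Group G']

/-- The Dehn function of a direct product is at most quadratic plus those of the factors. -/
theorem FinitePresentation.exists_prod (P : FinitePresentation G) (P' : FinitePresentation G') :
    ∃ (Q : FinitePresentation (G × G')) (C : ℕ), ∀ n,
      Q.dehn n ≤ C * P.dehn (C * n) + C * P'.dehn (C * n) + C * (n + 1) ^ 2 := by
  let I : FreeGroup (Fin P.numGens) →* FreeGroup (Fin (P.numGens + P'.numGens)) :=
    FreeGroup.map (Fin.castAdd _)
  let J : FreeGroup (Fin P'.numGens) →* FreeGroup (Fin (P.numGens + P'.numGens)) :=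
    FreeGroup.map (Fin.natAdd _)
  let π : FreeGroup (Fin (P.numGens + P'.numGens)) →* G × G' := FreeGroup.lift
    (Fin.addCases (fun i => (P.π (FreeGroup.of i), 1)) (fun j => (1, P'.π (FreeGroup.of j))))
  have hI : ∀ w, π (I w) = (P.π w, 1) := by
    intro w
    have : π.comp I = (MonoidHom.inl G G').comp P.π := by
      ext x <;> simp [π, I]
    exact DFunLike.congr_fun this w
  have hJ : ∀ w, π (J w) = (1, P'.π w) := by
    intro w
    have : π.comp J = (MonoidHom.inr G G').comp P'.π := by
      ext x <;> simp [π, J]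
    exact DFunLike.congr_fun this w
  have hπ : Function.Surjective π := by
    rintro ⟨a, b⟩
    obtain ⟨v, rfl⟩ := P.surjective a
    obtain ⟨w, rfl⟩ := P'.surjective b
    exact ⟨I v * J w, by simp [hI, hJ]⟩
  obtain ⟨p, hp⟩ := FreeGroup.exists_lift_of_surjective P.surjective ((MonoidHom.fst G G').comp π)
  obtain ⟨q, hq⟩ := FreeGroup.exists_lift_of_surjective P'.surjective ((MonoidHom.snd G G').comp π)
  -- The added relators split each generator `y` into words `p y` and `q y` for its two coordinates
  -- and make these words commute. Treating all generators alike avoids a case distinction.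
  let R : Set (FreeGroup (Fin (P.numGens + P'.numGens))) := I '' P.rels ∪ J '' P'.rels ∪
    Set.range (fun y => FreeGroup.of y * (I (p (FreeGroup.of y)) * J (q (FreeGroup.of y)))⁻¹) ∪
    Set.range (fun z : Fin (P.numGens + P'.numGens) × Fin (P.numGens + P'.numGens) =>
      I (p (FreeGroup.of z.1)) * J (q (FreeGroup.of z.2)) *
      (J (q (FreeGroup.of z.2)) * I (p (FreeGroup.of z.1)))⁻¹)
  have hRfin : R.Finite := (((P.finite_rels.image _).union (P'.finite_rels.image _)).union
    (Set.finite_range _)).union (Set.finite_range _)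
  have hR1 : ∀ r ∈ R, π r = 1 := by
    rintro r (((⟨x, hx, rfl⟩ | ⟨x, hx, rfl⟩) | ⟨y, rfl⟩) | ⟨z, rfl⟩)
    · simp [hI, P.map_rels hx]
    · simp [hJ, P'.map_rels hx]
    · rw [map_mul, map_inv, map_mul, hI, hJ, hp, hq, mul_inv_eq_one]
      simp
    · simp [hI, hJ]
  obtain ⟨M, hM⟩ := FreeGroup.exists_norm_map_le p
  obtain ⟨M', hM'⟩ := FreeGroup.exists_norm_map_le q
  have key : ∀ n w, π w = 1 → w.norm ≤ n →
      AreaLE R (n * (n + 2) + (P.dehn (M * n) + P'.dehn (M' * n))) w := by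
    intro n w hw hn
    have e1 : Close R (w.norm * ((w.norm + 2) * 1)) w (I (p w) * J (q w)) :=
      Close.lift_mul (MonoidHom.id _) (I.comp p) (J.comp q)
        (fun x => AreaLE.of_mem (Or.inl (Or.inr ⟨x, rfl⟩)))
        (fun x y => AreaLE.of_mem (Or.inr ⟨(x, y), rfl⟩)) w
    have e2 : AreaLE R (P.dehn (M * n) * 1) (I (p w)) :=
      (P.areaLE_dehn (by simp [hp, hw]) ((hM w).trans (by gcongr))).map I
        fun r hr => AreaLE.of_mem (Or.inl (Or.inl (Or.inl ⟨r, hr, rfl⟩)))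
    have e3 : AreaLE R (P'.dehn (M' * n) * 1) (J (q w)) :=
      (P'.areaLE_dehn (by simp [hq, hw]) ((hM' w).trans (by gcongr))).map J
        fun r hr => AreaLE.of_mem (Or.inl (Or.inl (Or.inr ⟨r, hr, rfl⟩)))
    refine (e1.areaLE (e2.mul e3)).mono_right ?_
    simp only [mul_one]
    gcongr
  refine ⟨.ofAreaLE π hπ R hRfin hR1 fun w hw => ⟨_, key _ w hw le_rfl⟩, M + M' + 1, fun n =>
    FinitePresentation.dehn_le _ fun w hw hn => (key n w hw hn).mono_right ?_⟩
  have h1 : P.dehn (M * n) ≤ (M + M' + 1) * P.dehn ((M + M' + 1) * n) :=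
    (P.dehn_mono (Nat.mul_le_mul_right n (by omega))).trans (Nat.le_mul_of_pos_left _ (by omega))
  have h2 : P'.dehn (M' * n) ≤ (M + M' + 1) * P'.dehn ((M + M' + 1) * n) :=
    (P'.dehn_mono (Nat.mul_le_mul_right n (by omega))).trans (Nat.le_mul_of_pos_left _ (by omega))
  have h3 : n * (n + 2) ≤ (M + M' + 1) * (n + 1) ^ 2 := by nlinarith [Nat.zero_le (M + M')]
  omega

/-- Some finite presentation of `G` has Dehn function dominated by `H`. -/
def DehnDominated (H : ℕ → ℕ) (G : Type*) [Group G] : Prop :=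
  ∃ (P : FinitePresentation G) (C : ℕ), ∀ n, P.dehn n ≤ C * H (C * (n + 1))

/-- Separating the two coordinates of a word takes quadratically many exchanges, which `H` absorbs
because it is at least quadratic. -/
theorem DehnDominated.prod {H : ℕ → ℕ} (hH : Monotone H) (hsq : ∀ n, n ^ 2 ≤ H n)
    (h : DehnDominated H G) (h' : DehnDominated H G') : DehnDominated H (G × G') := by
  obtain ⟨P, C, hC⟩ := h
  obtain ⟨P', C', hC'⟩ := h'
  obtain ⟨Q, D, hD⟩ := P.exists_prod P'
  set E := (D + 1) * (C + C' + 1) with hE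
  refine ⟨Q, E, fun n => (hD n).trans ?_⟩
  have hEn : ∀ c ≤ C + C' + 1, c * (D * n + 1) ≤ E * (n + 1) := by
    intro c hc
    rw [hE, mul_comm (D + 1), mul_assoc]
    refine Nat.mul_le_mul hc ?_
    nlinarith
  have h1 : P.dehn (D * n) ≤ C * H (E * (n + 1)) :=
    (hC _).trans (Nat.mul_le_mul_left _ (hH (hEn C (by omega))))
  have h2 : P'.dehn (D * n) ≤ C' * H (E * (n + 1)) :=
    (hC' _).trans (Nat.mul_le_mul_left _ (hH (hEn C' (by omega))))
  have h3 : (n + 1) ^ 2 ≤ H (E * (n + 1)) :=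
    (hsq _).trans (hH (Nat.le_mul_of_pos_left _ (by rw [hE]; positivity)))
  calc D * P.dehn (D * n) + D * P'.dehn (D * n) + D * (n + 1) ^ 2
      ≤ D * (C * H (E * (n + 1))) + D * (C' * H (E * (n + 1))) + D * H (E * (n + 1)) := by gcongr
    _ = D * (C + C' + 1) * H (E * (n + 1)) := by ring
    _ ≤ E * H (E * (n + 1)) := by rw [hE]; gcongr; omega

end Product

/-! ### Families of elements of linear word length -/

section LinearFamilies

variable {I : Type*} (n : I → ℕ)

/-- The group of families of elements of `G` whose word length with respect to some finite set
grows at most linearly in `n`. -/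
def linearFamilies (G : Type*) [Group G] : Subgroup (I → G) where
  -- The finite set is existentially quantified rather than a fixed generating set, which makes the
  -- construction functorial for arbitrary groups.
  carrier := {g | ∃ S : Set G, S.Finite ∧ ∃ C : ℕ, ∀ i, ∃ L : List G,
    (∀ x ∈ L, x ∈ S) ∧ L.length ≤ C * (n i + 1) ∧ L.prod = g i}
  one_mem' := ⟨∅, Set.finite_empty, 0, fun i => ⟨[], by simp, by simp, by simp⟩⟩
  mul_mem' := by
    rintro g h ⟨S, hS, C, hg⟩ ⟨T, hT, D, hh⟩
    refine ⟨S ∪ T, hS.union hT, C + D, fun i => ?_⟩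
    obtain ⟨L, h1, h2, h3⟩ := hg i
    obtain ⟨M, k1, k2, k3⟩ := hh i
    refine ⟨L ++ M, fun x hx => ?_, ?_, by simp [h3, k3]⟩
    · exact (List.mem_append.1 hx).imp (h1 x) (k1 x)
    · rw [List.length_append, add_mul]; omega
  inv_mem' := by
    rintro g ⟨S, hS, C, hg⟩
    refine ⟨(·⁻¹) '' S, hS.image _, C, fun i => ?_⟩
    obtain ⟨L, h1, h2, h3⟩ := hg i
    refine ⟨(L.map (·⁻¹)).reverse, fun x hx => ?_, by simpa using h2, ?_⟩
    · simp only [List.mem_reverse, List.mem_map] at hx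
      obtain ⟨y, hy, rfl⟩ := hx
      exact ⟨y, h1 y hy, rfl⟩
    · rw [← List.prod_inv_reverse, h3]; rfl

variable {n} {G G' : Type*} [Group G] [Group G']

/-- The map induced on linear families by a homomorphism. -/
def linearFamilies.map (p : G →* G') : linearFamilies n G →* linearFamilies n G' where
  toFun g := ⟨fun i => p (g.1 i), by
    obtain ⟨S, hS, C, hg⟩ := g.2
    refine ⟨p '' S, hS.image _, C, fun i => ?_⟩
    obtain ⟨L, h1, h2, h3⟩ := hg i
    refine ⟨L.map p, fun x hx => ?_, by simpa using h2, by simp [← map_list_prod, h3]⟩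
    obtain ⟨y, hy, rfl⟩ := List.mem_map.1 hx
    exact ⟨y, h1 y hy, rfl⟩⟩
  map_one' := by ext i; simp
  map_mul' g h := by ext i; simp

@[simp]
theorem linearFamilies.map_apply (p : G →* G') (g : linearFamilies n G) (i : I) :
    (linearFamilies.map p g).1 i = p (g.1 i) := rfl

/-- A family of values of words of linear length is linear. -/
theorem mem_linearFamilies_of_norm_le {k : ℕ} (θ : FreeGroup (Fin k) →* G)
    {w : I → FreeGroup (Fin k)} {C : ℕ} (hw : ∀ i, (w i).norm ≤ C * (n i + 1)) :
    (fun i => θ (w i)) ∈ linearFamilies n G := by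
  refine ⟨Set.range (fun z : Fin k × Bool => θ (FreeGroup.mk [z])), Set.finite_range _, C,
    fun i => ⟨(w i).toWord.map fun z => θ (FreeGroup.mk [z]), fun x hx => ?_, ?_, ?_⟩⟩
  · obtain ⟨z, -, rfl⟩ := List.mem_map.1 hx
    exact ⟨z, rfl⟩
  · rw [List.length_map]; exact hw i
  · have : ∀ L : List (Fin k × Bool),
        (L.map fun z => θ (FreeGroup.mk [z])).prod = θ (FreeGroup.mk L) := by
      intro L
      induction L with
      | nil => simp [← FreeGroup.one_eq_mk]
      | cons a L ih => rw [FreeGroup.mk_cons_eq_mul, map_mul, List.map_cons, List.prod_cons, ih]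
    rw [this, FreeGroup.mk_toWord]

/-- The values of a linear family are represented by words of linear length. -/
theorem exists_norm_le_of_mem_linearFamilies {k : ℕ} {θ : FreeGroup (Fin k) →* G}
    (hθ : Function.Surjective θ) {g : I → G} (hg : g ∈ linearFamilies n G) :
    ∃ C : ℕ, ∀ i, ∃ w, θ w = g i ∧ w.norm ≤ C * (n i + 1) := by
  obtain ⟨S, hS, C, hg⟩ := hg
  obtain ⟨M, hM⟩ := (hS.image fun x => (Function.surjInv hθ x).norm).bddAbove
  refine ⟨M * C, fun i => ?_⟩
  obtain ⟨L, h1, h2, h3⟩ := hg i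
  have key : ∀ L : List G, (∀ x ∈ L, x ∈ S) → ∃ w, θ w = L.prod ∧ w.norm ≤ M * L.length := by
    intro L
    induction L with
    | nil => exact fun _ => ⟨1, by simp, by simp⟩
    | cons a L ih =>
      intro h
      obtain ⟨w, h1, h2⟩ := ih fun x hx => h x (by simp [hx])
      refine ⟨Function.surjInv hθ a * w, by simp [h1, Function.surjInv_eq],
        (FreeGroup.norm_mul_le _ _).trans ?_⟩
      have := hM ⟨a, h a (by simp), rfl⟩
      simp only [List.length_cons, mul_add]
      simp only at this
      omega
  obtain ⟨w, h4, h5⟩ := key L h1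
  exact ⟨w, h4.trans h3, h5.trans (by rw [mul_assoc]; gcongr)⟩

/-- A word of minimal length representing `g`. -/
noncomputable def shortWord {k : ℕ} {θ : FreeGroup (Fin k) →* G} (hθ : Function.Surjective θ)
    (g : G) : FreeGroup (Fin k) :=
  Function.argminOn FreeGroup.norm {w | θ w = g} (hθ g)

theorem map_shortWord {k : ℕ} {θ : FreeGroup (Fin k) →* G} (hθ : Function.Surjective θ) (g : G) :
    θ (shortWord hθ g) = g :=
  Function.argminOn_mem FreeGroup.norm {w | θ w = g} (hθ g)

theorem norm_shortWord_le {k : ℕ} {θ : FreeGroup (Fin k) →* G} (hθ : Function.Surjective θ)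
    (w : FreeGroup (Fin k)) : (shortWord hθ (θ w)).norm ≤ w.norm :=
  Function.argminOn_le FreeGroup.norm {v | θ v = θ w} rfl

theorem exists_norm_shortWord_le {k : ℕ} {θ : FreeGroup (Fin k) →* G}
    (hθ : Function.Surjective θ) {g : I → G} (hg : g ∈ linearFamilies n G) :
    ∃ C : ℕ, ∀ i, (shortWord hθ (g i)).norm ≤ C * (n i + 1) := by
  obtain ⟨C, hC⟩ := exists_norm_le_of_mem_linearFamilies hθ hg
  refine ⟨C, fun i => ?_⟩
  obtain ⟨w, h1, h2⟩ := hC i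
  rw [← h1]
  exact (norm_shortWord_le hθ w).trans h2

end LinearFamilies

/-! ### Words modulo negligible area and induced homomorphisms -/

section Negligible

variable {I : Type*} (n : I → ℕ) (H : ℕ →o ℕ) {K : Type*} [Group K] {k : ℕ}
  (π : FreeGroup (Fin k) →* K)

/-- The families of words which can be filled, with a common finite set of relations of `K`, with
area dominated by `H`. -/
def negligible : Subgroup (I → FreeGroup (Fin k)) where
  carrier := {u | ∃ R : Set (FreeGroup (Fin k)), R.Finite ∧ (∀ r ∈ R, π r = 1) ∧
    ∃ C : ℕ, ∀ i, AreaLE R (C * H (C * (n i + 1))) (u i)}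
  one_mem' := ⟨∅, Set.finite_empty, by simp, 0, fun i => AreaLE.one _ _⟩
  mul_mem' := by
    rintro u v ⟨R, hR, hR1, C, hu⟩ ⟨S, hS, hS1, D, hv⟩
    refine ⟨R ∪ S, hR.union hS, ?_, C + D, fun i => ?_⟩
    · rintro r (hr | hr)
      exacts [hR1 r hr, hS1 r hr]
    · refine (((hu i).mono Set.subset_union_left le_rfl).mul
        ((hv i).mono Set.subset_union_right le_rfl)).mono_right ?_
      rw [add_mul C D (H _)]
      exact add_le_add
        (Nat.mul_le_mul_left _ (H.monotone (Nat.mul_le_mul_right _ (Nat.le_add_right C D))))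
        (Nat.mul_le_mul_left _ (H.monotone (Nat.mul_le_mul_right _ (Nat.le_add_left D C))))
  inv_mem' := by
    rintro u ⟨R, hR, hR1, C, hu⟩
    exact ⟨R, hR, hR1, C, fun i => (hu i).inv⟩

/-- Area does not see the length of conjugators, so the conjugating family need not be linear. -/
instance negligible_normal : (negligible n H π).Normal where
  conj_mem := by
    rintro u ⟨R, hR, hR1, C, hu⟩ g
    exact ⟨R, hR, hR1, C, fun i => (hu i).conj (g i)⟩

variable {n H π} {G G' : Type*} [Group G] [Group G']

/-- A relation of linear length in `G` is filled there, and the filling is carried to `K` by `V`.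
The images of the relators of `G` form one finite set serving all indices. -/
theorem map_mem_negligible {P : FinitePresentation G} {D : ℕ}
    (hD : ∀ m, P.dehn m ≤ D * H (D * (m + 1))) {ν : G →* K}
    {V : FreeGroup (Fin P.numGens) →* FreeGroup (Fin k)} (hV : ∀ w, π (V w) = ν (P.π w))
    {w : I → FreeGroup (Fin P.numGens)} {C : ℕ} (hw : ∀ i, (w i).norm ≤ C * (n i + 1))
    (hw1 : ∀ i, P.π (w i) = 1) : (fun i => V (w i)) ∈ negligible n H π := by
  refine ⟨V '' P.rels, P.finite_rels.image _, ?_, D * (C + 1), fun i => ?_⟩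
  · rintro _ ⟨r, hr, rfl⟩
    simp [hV, P.map_rels hr]
  · refine ((P.areaLE_dehn (hw1 i) (hw i)).map V
      (S := V '' P.rels) fun r hr => AreaLE.of_mem (Set.mem_image_of_mem V hr)).mono_right ?_
    rw [mul_one]
    refine (hD _).trans (Nat.mul_le_mul (Nat.le_mul_of_pos_right _ (by omega)) (H.monotone ?_))
    rw [mul_assoc]
    exact Nat.mul_le_mul_left _ (by nlinarith)

theorem mk_eq_mk_of_forall {u v : I → FreeGroup (Fin k)}
    (h : (fun i => u i * (v i)⁻¹) ∈ negligible n H π) :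
    (u : (I → FreeGroup (Fin k)) ⧸ negligible n H π) = v := by
  rw [QuotientGroup.eq_iff_div_mem, div_eq_mul_inv]
  exact h

/-- Two letterwise lifts of the same homomorphism differ by one relator per letter, a linear cost
that is below `H`. -/
theorem mk_lift_eq_mk_lift (hsq : ∀ m, m ^ 2 ≤ H m) {l : ℕ}
    {V V' : FreeGroup (Fin l) →* FreeGroup (Fin k)} (hV : ∀ w, π (V w) = π (V' w))
    {w : I → FreeGroup (Fin l)} {C : ℕ} (hw : ∀ i, (w i).norm ≤ C * (n i + 1)) :
    ((fun i => V (w i) : I → FreeGroup (Fin k)) : (I → FreeGroup (Fin k)) ⧸ negligible n H π) =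
      (fun i => V' (w i) : I → FreeGroup (Fin k)) := by
  refine mk_eq_mk_of_forall ⟨Set.range fun x => V (FreeGroup.of x) * (V' (FreeGroup.of x))⁻¹,
    Set.finite_range _, ?_, C + 1, fun i => ?_⟩
  · rintro _ ⟨x, rfl⟩
    simp [hV]
  · refine (Close.lift V V' (fun x => AreaLE.of_mem (Set.mem_range_self x)) (w i)).mono_right ?_
    rw [mul_one]
    refine (hw i).trans ?_
    have h1 := hsq ((C + 1) * (n i + 1))
    have h2 : (C + 1) * (n i + 1) ≤ ((C + 1) * (n i + 1)) ^ 2 :=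
      Nat.le_self_pow (by norm_num) _
    have h3 : H ((C + 1) * (n i + 1)) ≤ (C + 1) * H ((C + 1) * (n i + 1)) :=
      Nat.le_mul_of_pos_left _ (by omega)
    nlinarith

/-- A word representing `ν g`, obtained by applying `ν` letter by letter to a short word
for `g`. -/
noncomputable def wordLift (hπ : Function.Surjective π) (hG : DehnDominated H G) (ν : G →* K)
    (g : G) : FreeGroup (Fin k) :=
  (FreeGroup.exists_lift_of_surjective hπ (ν.comp hG.choose.π)).choose
    (shortWord hG.choose.surjective g)

theorem map_wordLift (hπ : Function.Surjective π) (hG : DehnDominated H G) (ν : G →* K) (g : G) :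
    π (wordLift hπ hG ν g) = ν g := by
  rw [wordLift, (FreeGroup.exists_lift_of_surjective hπ (ν.comp hG.choose.π)).choose_spec,
    MonoidHom.comp_apply, map_shortWord]

/-- The homomorphism from linear families in `G` to families of words in the generators of `K`
modulo negligible ones which is induced by a homomorphism `G →* K`. -/
noncomputable def familyHom (hπ : Function.Surjective π) (hG : DehnDominated H G) (ν : G →* K) :
    linearFamilies n G →* (I → FreeGroup (Fin k)) ⧸ negligible n H π :=
  MonoidHom.mk' (fun g => ((fun i => wordLift hπ hG ν (g.1 i) : I → FreeGroup (Fin k)) :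
    (I → FreeGroup (Fin k)) ⧸ negligible n H π)) (by
    intro g h
    have hs := hG.choose.surjective
    rw [← QuotientGroup.mk_mul, eq_comm]
    refine mk_eq_mk_of_forall ?_
    obtain ⟨D, hD⟩ := hG.choose_spec
    obtain ⟨C₁, h₁⟩ := exists_norm_shortWord_le hs g.2
    obtain ⟨C₂, h₂⟩ := exists_norm_shortWord_le hs h.2
    obtain ⟨C₃, h₃⟩ := exists_norm_shortWord_le hs (g * h).2
    -- The product of the three short words is trivial already in `G` and has linear length, so it
    -- is filled by the Dehn function of `G`.
    have := map_mem_negligible (n := n) (π := π) hD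
      (FreeGroup.exists_lift_of_surjective hπ (ν.comp hG.choose.π)).choose_spec
      (w := fun i => shortWord hs (g.1 i) * shortWord hs (h.1 i) *
        (shortWord hs ((g * h).1 i))⁻¹) (C := C₁ + C₂ + C₃)
      (fun i => by
        refine (FreeGroup.norm_mul_le _ _).trans ?_
        have := FreeGroup.norm_mul_le (shortWord hs (g.1 i)) (shortWord hs (h.1 i))
        have a1 := h₁ i
        have a2 := h₂ i
        have a3 := h₃ i
        rw [FreeGroup.norm_inv_eq, add_mul, add_mul]
        omega)
      (fun i => by simp [map_shortWord])
    simpa [wordLift] using this)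

theorem familyHom_apply (hπ : Function.Surjective π) (hG : DehnDominated H G) (ν : G →* K)
    (g : linearFamilies n G) : familyHom hπ hG ν g =
      ((fun i => wordLift hπ hG ν (g.1 i) : I → FreeGroup (Fin k)) :
        (I → FreeGroup (Fin k)) ⧸ negligible n H π) := rfl

/-- `familyHom` may be computed with any choice of linear words. -/
theorem familyHom_eq_mk (hsq : ∀ m, m ^ 2 ≤ H m) (hπ : Function.Surjective π)
    (hG : DehnDominated H G) (ν : G →* K) {l : ℕ} (θ : FreeGroup (Fin l) →* G)
    {V : FreeGroup (Fin l) →* FreeGroup (Fin k)} (hV : ∀ w, π (V w) = ν (θ w))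
    {w : I → FreeGroup (Fin l)} {C : ℕ} (hw : ∀ i, (w i).norm ≤ C * (n i + 1))
    {g : linearFamilies n G} (hg : ∀ i, θ (w i) = g.1 i) :
    familyHom hπ hG ν g = ((fun i => V (w i) : I → FreeGroup (Fin k)) :
        (I → FreeGroup (Fin k)) ⧸ negligible n H π) := by
  have hs := hG.choose.surjective
  obtain ⟨θ', hθ'⟩ := FreeGroup.exists_lift_of_surjective hs θ
  obtain ⟨D, hD⟩ := hG.choose_spec
  have hV' := (FreeGroup.exists_lift_of_surjective hπ (ν.comp hG.choose.π)).choose_spec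
  set V' := (FreeGroup.exists_lift_of_surjective hπ (ν.comp hG.choose.π)).choose with hV'def
  obtain ⟨M, hM⟩ := FreeGroup.exists_norm_map_le θ'
  have hθw : ∀ i, (θ' (w i)).norm ≤ M * C * (n i + 1) := fun i =>
    (hM _).trans (by rw [mul_assoc]; exact Nat.mul_le_mul_left _ (hw i))
  obtain ⟨C₁, h₁⟩ := exists_norm_shortWord_le hs g.2
  -- The change of words is made in two stages: within the chosen presentation of `G`, after
  -- rewriting the letters by `θ'`, by a filling in `G`; then between two letterwise lifts of the
  -- same words.
  have e1 : familyHom hπ hG ν g = ((fun i => V' (θ' (w i)) : I → FreeGroup (Fin k)) :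
        (I → FreeGroup (Fin k)) ⧸ negligible n H π) := by
    rw [familyHom_apply]
    refine mk_eq_mk_of_forall ?_
    have := map_mem_negligible (n := n) (π := π) hD hV'
      (w := fun i => shortWord hs (g.1 i) * (θ' (w i))⁻¹) (C := C₁ + M * C)
      (fun i => by
        refine (FreeGroup.norm_mul_le _ _).trans ?_
        rw [FreeGroup.norm_inv_eq, add_mul]
        exact add_le_add (h₁ i) (hθw i))
      (fun i => by simp [map_shortWord, hθ', hg])
    simpa [wordLift, ← hV'def] using this
  rw [e1]
  exact mk_lift_eq_mk_lift hsq (V := V'.comp θ') (V' := V)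
    (fun v => by simp [hV', hV, hθ']) hw

/-- Both sides can be computed from the same short words for `g` and the same lift `V`, by
`familyHom_eq_mk`. -/
theorem familyHom_comp (hsq : ∀ m, m ^ 2 ≤ H m) (hπ : Function.Surjective π)
    (hG : DehnDominated H G) (hG' : DehnDominated H G') (p : G →* G') (ν : G' →* K)
    (g : linearFamilies n G) :
    familyHom hπ hG (ν.comp p) g = familyHom hπ hG' ν (linearFamilies.map p g) := by
  have hs := hG.choose.surjective
  obtain ⟨C, hC⟩ := exists_norm_shortWord_le hs g.2
  obtain ⟨V, hV⟩ := FreeGroup.exists_lift_of_surjective hπ ((ν.comp p).comp hG.choose.π)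
  rw [familyHom_eq_mk hsq hπ hG (ν.comp p) hG.choose.π hV hC fun i => map_shortWord hs _,
    familyHom_eq_mk hsq hπ hG' ν (p.comp hG.choose.π) hV hC fun i => by simp [map_shortWord]]

/-- Commuting `μ` and `ν` combine to a homomorphism on `G × G'`, whose Dehn function is still
dominated by `H`. Both induced maps factor through its family homomorphism, and families in the two
factors commute before it is applied. -/
theorem familyHom_commute (hsq : ∀ m, m ^ 2 ≤ H m) (hπ : Function.Surjective π)
    (hG : DehnDominated H G) (hG' : DehnDominated H G') (μ : G →* K) (ν : G' →* K)
    (hc : ∀ x y, Commute (μ x) (ν y)) (g : linearFamilies n G) (h : linearFamilies n G') :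
    Commute (familyHom hπ hG μ g) (familyHom hπ hG' ν h) := by
  have hGG := hG.prod H.monotone hsq hG'
  have e1 := familyHom_comp hsq hπ hG hGG (MonoidHom.inl G G') (μ.noncommCoprod ν hc) g
  have e2 := familyHom_comp hsq hπ hG' hGG (MonoidHom.inr G G') (μ.noncommCoprod ν hc) h
  rw [MonoidHom.noncommCoprod_comp_inl] at e1
  rw [MonoidHom.noncommCoprod_comp_inr] at e2
  rw [e1, e2]
  refine Commute.map (Subtype.ext (funext fun i => ?_)) _
  simp [MonoidHom.inl, MonoidHom.inr, linearFamilies.map]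

/-- `ξ` is the diagonal of `G` followed by the homomorphism `G × G →* K` built from `μ` and `ν.comp
p`. Working with `G × G` requires commutation only with the values of `ν` on the image of `p`. -/
theorem familyHom_mul (hsq : ∀ m, m ^ 2 ≤ H m) (hπ : Function.Surjective π)
    (hG : DehnDominated H G) (hG' : DehnDominated H G') (ξ μ : G →* K) (ν : G' →* K) (p : G →* G')
    (hc : ∀ x y, Commute (μ x) (ν (p y))) (hξ : ∀ x, ξ x = μ x * ν (p x))
    (g : linearFamilies n G) : familyHom hπ hG ξ g =
      familyHom hπ hG μ g * familyHom hπ hG' ν (linearFamilies.map p g) := by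
  have hGG := hG.prod H.monotone hsq hG
  have e1 := familyHom_comp hsq hπ hG hGG (MonoidHom.inl G G) (μ.noncommCoprod (ν.comp p) hc) g
  have e2 := familyHom_comp hsq hπ hG hGG (MonoidHom.inr G G) (μ.noncommCoprod (ν.comp p) hc) g
  have e3 := familyHom_comp hsq hπ hG hGG ((MonoidHom.id G).prod (MonoidHom.id G))
    (μ.noncommCoprod (ν.comp p) hc) g
  rw [MonoidHom.noncommCoprod_comp_inl] at e1
  rw [MonoidHom.noncommCoprod_comp_inr] at e2
  have e4 : (μ.noncommCoprod (ν.comp p) hc).comp ((MonoidHom.id G).prod (MonoidHom.id G)) = ξ := by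
    ext x; simp [hξ]
  rw [e4] at e3
  rw [← familyHom_comp hsq hπ hG hG' p ν, e1, e2, e3, ← map_mul]
  congr 1
  refine Subtype.ext (funext fun i => ?_)
  simp [linearFamilies.map]

end Negligible

/-! ### Abstract identities behind the normal form -/

section Algebra

variable {G₁ G₂ G₃ G₄ A B Q : Type*} [Group G₁] [Group G₂] [Group G₃] [Group G₄] [CommGroup A]
  [CommGroup B] [Group Q]

/-- The conjugation action of `σ₃` on products `σ₁ x * σ₂ y` with `α₁ x * α₂ y = 1`, computed from
the relations between different lifts. -/
theorem conj_of_swap {σ₁ σ₁' : G₁ →* Q} {σ₂ σ₂' : G₂ →* Q} {σ₃ σ₃' σ₃'' : G₃ →* Q}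
    {α₁ : G₁ →* A} {α₂ : G₂ →* A} {α₃ : G₃ →* A} {β₃ : G₃ →* B} {s₁ : A →* G₁} {s₂ : A →* G₂}
    {t₂ : B →* G₂} (hs : ∀ a, α₂ (s₂ a) = a)
    (h₁ : ∀ x, σ₁ x = σ₁' x * σ₂ (s₂ (α₁ x))) (h₂ : ∀ y, σ₂ y = σ₂' y * σ₁ (s₁ (α₂ y)))
    (h₃ : ∀ g, σ₃' g = σ₃ g * σ₂ (t₂ (β₃ g))) (h₄ : ∀ g, σ₃'' g = σ₃' g * σ₁' (s₁ (α₃ g)))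
    (c₁₂ : ∀ x y, Commute (σ₁ x) (σ₂ y)) (c₃₂ : ∀ g y, Commute (σ₃' g) (σ₂' y))
    (c₃₁ : ∀ g x, Commute (σ₃'' g) (σ₁' x)) (g : G₃) (x : G₁) (y : G₂) (hxy : α₁ x * α₂ y = 1) :
    σ₃ g * (σ₁ x * σ₂ y) = σ₁ ((s₁ (α₃ g))⁻¹ * x * s₁ (α₃ g)) *
      σ₂ ((t₂ (β₃ g))⁻¹ * y * t₂ (β₃ g)) * σ₃ g := by
  -- When the `A`-parts of `x` and `y` cancel, the two factors can correct each other instead of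
  -- using a third one.
  have swap : ∀ x y, α₁ x * α₂ y = 1 → σ₁ x * σ₂ y = σ₁' x * σ₂' (s₂ (α₁ x) * y) := by
    intro x y h
    have := h₂ (s₂ (α₁ x) * y)
    rw [map_mul α₂, hs, h, map_one, map_one, mul_one] at this
    rw [← this, h₁ x, map_mul, mul_assoc]
  -- `σ₃'` differs by a value of `σ₁'` from `σ₃''`, which commutes with `σ₁'`; so it acts on the
  -- image of `σ₁'` as that value does.
  have e₄ : ∀ g x, σ₃' g * σ₁' x = σ₁' ((s₁ (α₃ g))⁻¹ * x * s₁ (α₃ g)) * σ₃' g := by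
    intro g x
    have e : σ₃' g = σ₃'' g * (σ₁' (s₁ (α₃ g)))⁻¹ := by rw [h₄]; group
    have c := (c₃₁ g ((s₁ (α₃ g))⁻¹ * x)).eq
    have c' := (c₃₁ g (s₁ (α₃ g))⁻¹).eq
    simp only [map_mul, map_inv] at c c' ⊢
    rw [e, mul_assoc, c, c']
    group
  have e₃ : ∀ g x y, α₁ x * α₂ y = 1 →
      σ₃' g * (σ₁ x * σ₂ y) = σ₁ ((s₁ (α₃ g))⁻¹ * x * s₁ (α₃ g)) * σ₂ y * σ₃' g := by
    intro g x y h
    have hα : α₁ ((s₁ (α₃ g))⁻¹ * x * s₁ (α₃ g)) = α₁ x := by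
      simp only [map_mul, map_inv]
      rw [mul_comm, mul_inv_cancel_left]
    rw [swap x y h, swap _ y (by rw [hα, h]), hα, ← mul_assoc, e₄, mul_assoc (σ₁' _),
      (c₃₂ g _).eq, mul_assoc (σ₁' _)]
  -- The remaining factor of `σ₃` is a value of `σ₂`: it passes through `σ₁ x` and conjugates `y` by
  -- `t₂ (β₃ g)`.
  have e : σ₃ g = σ₃' g * (σ₂ (t₂ (β₃ g)))⁻¹ := by rw [h₃]; group
  have hα : α₂ ((t₂ (β₃ g))⁻¹ * y * t₂ (β₃ g)) = α₂ y := by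
    simp only [map_mul, map_inv]
    rw [mul_comm, mul_inv_cancel_left]
  have key := e₃ g x ((t₂ (β₃ g))⁻¹ * y * t₂ (β₃ g)) (by rw [hα, hxy])
  have c := (c₁₂ x (t₂ (β₃ g))⁻¹).eq
  rw [map_inv] at c
  calc σ₃ g * (σ₁ x * σ₂ y)
      = σ₃' g * (((σ₂ (t₂ (β₃ g)))⁻¹ * σ₁ x) * σ₂ y) := by rw [e]; group
    _ = σ₃' g * (σ₁ x * σ₂ ((t₂ (β₃ g))⁻¹ * y * t₂ (β₃ g))) * (σ₂ (t₂ (β₃ g)))⁻¹ := by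
        rw [← c]; simp only [map_mul, map_inv]; group
    _ = _ := by rw [key, e]; group

/-- The normal form is multiplicative. -/
theorem normalForm_mul {σ₁ : G₁ →* Q} {σ₂ : G₂ →* Q} {σ₃ : G₃ →* Q} {σ₄ : G₄ →* Q}
    {α₁ : G₁ →* A} {α₂ : G₂ →* A} {α₃ : G₃ →* A} {α₄ : G₄ →* A}
    {β₁ : G₁ →* B} {β₂ : G₂ →* B} {β₃ : G₃ →* B} {β₄ : G₄ →* B} {s : A →* G₁} {t : B →* G₂}
    (hαs : ∀ a, α₁ (s a) = a) (hβs : ∀ a, β₁ (s a) = 1)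
    (hβt : ∀ b, β₂ (t b) = b) (hαt : ∀ b, α₂ (t b) = 1)
    (c₁₂ : ∀ x y, Commute (σ₁ x) (σ₂ y)) (c₃₄ : ∀ x y, Commute (σ₃ x) (σ₄ y))
    (h₃ : ∀ g x y, α₁ x * α₂ y = 1 → σ₃ g * (σ₁ x * σ₂ y) =
      σ₁ ((s (α₃ g))⁻¹ * x * s (α₃ g)) * σ₂ ((t (β₃ g))⁻¹ * y * t (β₃ g)) * σ₃ g)
    (h₄ : ∀ g x y, β₁ x * β₂ y = 1 → σ₄ g * (σ₁ x * σ₂ y) =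
      σ₁ ((s (α₄ g))⁻¹ * x * s (α₄ g)) * σ₂ ((t (β₄ g))⁻¹ * y * t (β₄ g)) * σ₄ g)
    (g₁ h₁' : G₁) (g₂ h₂' : G₂) (g₃ h₃' : G₃) (g₄ h₄' : G₄)
    (hα : α₁ h₁' * α₂ h₂' * α₃ h₃' * α₄ h₄' = 1) (hβ : β₁ h₁' * β₂ h₂' * β₃ h₃' * β₄ h₄' = 1) :
    σ₁ (g₁ * s (α₃ g₃ * α₄ g₄)) * σ₂ (g₂ * t (β₃ g₃ * β₄ g₄)) * σ₃ g₃ * σ₄ g₄ *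
      (σ₁ (h₁' * s (α₃ h₃' * α₄ h₄')) * σ₂ (h₂' * t (β₃ h₃' * β₄ h₄')) * σ₃ h₃' * σ₄ h₄') =
    σ₁ (g₁ * h₁' * s (α₃ (g₃ * h₃') * α₄ (g₄ * h₄'))) *
      σ₂ (g₂ * h₂' * t (β₃ (g₃ * h₃') * β₄ (g₄ * h₄'))) * σ₃ (g₃ * h₃') * σ₄ (g₄ * h₄') := by
  set x := h₁' * s (α₃ h₃' * α₄ h₄') with hx
  set y := h₂' * t (β₃ h₃' * β₄ h₄') with hy
  have hαxy : α₁ x * α₂ y = 1 := by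
    rw [hx, hy, map_mul α₁, map_mul α₂, hαs, hαt, mul_one, ← hα]
    simp only [mul_assoc, mul_comm, mul_left_comm]
  have hβxy : β₁ x * β₂ y = 1 := by
    rw [hx, hy, map_mul β₁, map_mul β₂, hβt, hβs, mul_one, ← hβ]
    simp only [mul_assoc]
  set x' := (s (α₄ g₄))⁻¹ * x * s (α₄ g₄) with hx'
  set y' := (t (β₄ g₄))⁻¹ * y * t (β₄ g₄) with hy'
  have hαxy' : α₁ x' * α₂ y' = 1 := by
    rw [hx', hy', ← hαxy]
    simp only [map_mul, map_inv]
    rw [mul_comm _ (α₁ (s (α₄ g₄))), mul_inv_cancel_left, mul_comm _ (α₂ (t (β₄ g₄))),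
      mul_inv_cancel_left]
  set x'' := (s (α₃ g₃))⁻¹ * x' * s (α₃ g₃) with hx''
  set y'' := (t (β₃ g₃))⁻¹ * y' * t (β₃ g₃) with hy''
  -- The section value attached to `g₁` is what cancels the left half of the two successive
  -- conjugations of `x`; the right half supplies the section value of the product.
  have e1 : g₁ * s (α₃ g₃ * α₄ g₄) * x'' =
      g₁ * h₁' * s (α₃ (g₃ * h₃') * α₄ (g₄ * h₄')) := by
    have : s (α₃ (g₃ * h₃') * α₄ (g₄ * h₄')) =
        s (α₃ h₃' * α₄ h₄') * (s (α₄ g₄) * s (α₃ g₃)) := by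
      simp only [← map_mul s, map_mul α₃, map_mul α₄]
      congr 1
      simp only [mul_assoc, mul_comm, mul_left_comm]
    rw [this, mul_comm (α₃ g₃), map_mul s, hx'', hx', hx]
    group
  have e2 : g₂ * t (β₃ g₃ * β₄ g₄) * y'' =
      g₂ * h₂' * t (β₃ (g₃ * h₃') * β₄ (g₄ * h₄')) := by
    have : t (β₃ (g₃ * h₃') * β₄ (g₄ * h₄')) =
        t (β₃ h₃' * β₄ h₄') * (t (β₄ g₄) * t (β₃ g₃)) := by
      simp only [← map_mul t, map_mul β₃, map_mul β₄]
      congr 1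
      simp only [mul_assoc, mul_comm, mul_left_comm]
    rw [this, mul_comm (β₃ g₃), map_mul t, hy'', hy', hy]
    group
  rw [← e1, ← e2]
  have k4 := h₄ g₄ x y hβxy
  have k3 := h₃ g₃ x' y' hαxy'
  rw [← hx', ← hy'] at k4
  rw [← hx'', ← hy''] at k3
  have k12 := (c₁₂ x'' (g₂ * t (β₃ g₃ * β₄ g₄))).eq
  have k34 := (c₃₄ h₃' g₄).eq
  rw [map_mul σ₁ _ x'', map_mul σ₂ _ y'', map_mul σ₃, map_mul σ₄]
  generalize σ₁ (g₁ * s (α₃ g₃ * α₄ g₄)) = p₁ at *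
  generalize σ₂ (g₂ * t (β₃ g₃ * β₄ g₄)) = p₂ at *
  calc p₁ * p₂ * σ₃ g₃ * σ₄ g₄ * (σ₁ x * σ₂ y * σ₃ h₃' * σ₄ h₄')
      = p₁ * p₂ * σ₃ g₃ * (σ₄ g₄ * (σ₁ x * σ₂ y)) * σ₃ h₃' * σ₄ h₄' := by group
    _ = p₁ * p₂ * (σ₃ g₃ * (σ₁ x' * σ₂ y')) * σ₄ g₄ * σ₃ h₃' * σ₄ h₄' := by rw [k4]; group
    _ = p₁ * (p₂ * σ₁ x'') * σ₂ y'' * σ₃ g₃ * (σ₄ g₄ * σ₃ h₃') * σ₄ h₄' := by rw [k3]; group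
    _ = _ := by rw [← k12, ← k34]; group

end Algebra

/-! ### Twisted embeddings of the factors into the kernel -/

/-- Homomorphisms from four groups to the product `A × B`, together with sections over both
factors. -/
structure BiSplitting (G : Fin 4 → Type*) [∀ i, Group (G i)] (A B : Type*) [CommGroup A]
    [CommGroup B] where
  α : ∀ i, G i →* A
  β : ∀ i, G i →* B
  s : ∀ i, A →* G i
  t : ∀ i, B →* G i
  α_s : ∀ i a, α i (s i a) = a
  β_s : ∀ i a, β i (s i a) = 1
  α_t : ∀ i b, α i (t i b) = 1
  β_t : ∀ i b, β i (t i b) = b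

namespace BiSplitting

variable {G : Fin 4 → Type*} [∀ i, Group (G i)] {A B : Type*} [CommGroup A] [CommGroup B]
  (D : BiSplitting G A B)

/-- The product of the coordinate maps to `A`. -/
def totalα : (∀ i, G i) →* A := ∏ i, (D.α i).comp (Pi.evalMonoidHom G i)

/-- The product of the coordinate maps to `B`. -/
def totalβ : (∀ i, G i) →* B := ∏ i, (D.β i).comp (Pi.evalMonoidHom G i)

theorem totalα_apply (g : ∀ i, G i) : D.totalα g = ∏ i, D.α i (g i) := by
  simp [totalα, MonoidHom.finsetProd_apply]

theorem totalβ_apply (g : ∀ i, G i) : D.totalβ g = ∏ i, D.β i (g i) := by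
  simp [totalβ, MonoidHom.finsetProd_apply]

theorem totalα_mulSingle (i : Fin 4) (x : G i) : D.totalα (Pi.mulSingle i x) = D.α i x := by
  rw [totalα_apply, Finset.prod_eq_single i]
  · simp
  · intro j _ hj; simp [Pi.mulSingle_eq_of_ne hj]
  · simp

theorem totalβ_mulSingle (i : Fin 4) (x : G i) : D.totalβ (Pi.mulSingle i x) = D.β i x := by
  rw [totalβ_apply, Finset.prod_eq_single i]
  · simp
  · intro j _ hj; simp [Pi.mulSingle_eq_of_ne hj]
  · simp

/-- The kernel of the total map to `A × B`. -/
def kernel : Subgroup (∀ i, G i) := D.totalα.ker ⊓ D.totalβ.ker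

theorem mem_kernel {g : ∀ i, G i} : g ∈ D.kernel ↔ D.totalα g = 1 ∧ D.totalβ g = 1 := Iff.rfl

/-- The embedding of a factor into the kernel which compensates the `A`-part in the `j`-th and the
`B`-part in the `k`-th factor. -/
def twist (i j k : Fin 4) (hij : i ≠ j) (hik : i ≠ k) (hjk : j ≠ k) : G i →* D.kernel where
  toFun x := ⟨Pi.mulSingle i x * Pi.mulSingle j (D.s j (D.α i x)⁻¹) *
    Pi.mulSingle k (D.t k (D.β i x)⁻¹), by
      rw [mem_kernel]
      simp only [map_mul, totalα_mulSingle, totalβ_mulSingle, D.α_s, D.β_s, D.α_t, D.β_t]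
      simp⟩
  map_one' := by ext; simp
  map_mul' x y := by
    refine Subtype.ext (funext fun c => ?_)
    simp only [Subgroup.coe_mul, Pi.mul_apply]
    by_cases hi : c = i
    · subst hi; simp [hij, hik, Pi.mulSingle_eq_of_ne]
    by_cases hj : c = j
    · subst hj
      simp only [map_mul, mul_inv, Pi.mulSingle_eq_same, Pi.mulSingle_eq_of_ne hi,
        Pi.mulSingle_eq_of_ne hjk, one_mul, mul_one]
    by_cases hk : c = k
    · subst hk
      simp only [map_mul, mul_inv, Pi.mulSingle_eq_same, Pi.mulSingle_eq_of_ne hi,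
        Pi.mulSingle_eq_of_ne hj, one_mul]
    · simp [Pi.mulSingle_eq_of_ne hi, Pi.mulSingle_eq_of_ne hj, Pi.mulSingle_eq_of_ne hk]

theorem coe_twist {i j k : Fin 4} (hij : i ≠ j) (hik : i ≠ k) (hjk : j ≠ k) (x : G i) (c : Fin 4) :
    (D.twist i j k hij hik hjk x).1 c = (Pi.mulSingle i x : ∀ i, G i) c *
      (Pi.mulSingle j (D.s j (D.α i x)⁻¹) : ∀ i, G i) c *
      (Pi.mulSingle k (D.t k (D.β i x)⁻¹) : ∀ i, G i) c := rfl

theorem coe_twist_s {i j k : Fin 4} (hij : i ≠ j) (hik : i ≠ k) (hjk : j ≠ k) (a : A) (c : Fin 4) :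
    (D.twist i j k hij hik hjk (D.s i a)).1 c = (Pi.mulSingle i (D.s i a) : ∀ i, G i) c *
      (Pi.mulSingle j (D.s j a⁻¹) : ∀ i, G i) c := by
  simp [coe_twist, D.α_s, D.β_s]

theorem coe_twist_t {i j k : Fin 4} (hij : i ≠ j) (hik : i ≠ k) (hjk : j ≠ k) (b : B) (c : Fin 4) :
    (D.twist i j k hij hik hjk (D.t i b)).1 c = (Pi.mulSingle i (D.t i b) : ∀ i, G i) c *
      (Pi.mulSingle k (D.t k b⁻¹) : ∀ i, G i) c := by
  simp [coe_twist, D.α_t, D.β_t]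

theorem commute_s (i : Fin 4) (a b : A) : Commute (D.s i a) (D.s i b) :=
  (Commute.all a b).map (D.s i)

theorem commute_t (i : Fin 4) (a b : B) : Commute (D.t i a) (D.t i b) :=
  (Commute.all a b).map (D.t i)

variable {i j k l : Fin 4} (hij : i ≠ j) (hik : i ≠ k) (hil : i ≠ l) (hjk : j ≠ k) (hjl : j ≠ l)
  (hkl : k ≠ l)

include hil in
-- The two images overlap only in the coordinates `j` and `k`, where their entries lie in the
-- abelian images of `s j` and `t k`.
theorem twist_commute (x : G i) (y : G l) : Commute (D.twist i j k hij hik hjk x)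
    (D.twist l j k hjl.symm hkl.symm hjk y) := by
  refine Subtype.ext (funext fun c => ?_)
  simp only [Subgroup.coe_mul, Pi.mul_apply, coe_twist]
  by_cases hi : c = i
  · subst hi
    simp [Pi.mulSingle_eq_of_ne hij, Pi.mulSingle_eq_of_ne hik, Pi.mulSingle_eq_of_ne hil]
  by_cases hl : c = l
  · subst hl
    simp [Pi.mulSingle_eq_of_ne hjl.symm, Pi.mulSingle_eq_of_ne hkl.symm, Pi.mulSingle_eq_of_ne hi]
  by_cases hj : c = j
  · subst hj
    simp only [Pi.mulSingle_eq_same, Pi.mulSingle_eq_of_ne hi, Pi.mulSingle_eq_of_ne hl,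
        Pi.mulSingle_eq_of_ne hjk, one_mul, mul_one]
    exact D.commute_s _ _ _
  by_cases hk : c = k
  · subst hk
    simp only [Pi.mulSingle_eq_same, Pi.mulSingle_eq_of_ne hi, Pi.mulSingle_eq_of_ne hl,
        Pi.mulSingle_eq_of_ne hj, one_mul]
    exact D.commute_t _ _ _
  · simp [Pi.mulSingle_eq_of_ne hi, Pi.mulSingle_eq_of_ne hj, Pi.mulSingle_eq_of_ne hk,
      Pi.mulSingle_eq_of_ne hl]

include hjk hij in
theorem twist_commute_s {k' : Fin 4} (hlk' : l ≠ k') (hjk' : j ≠ k') (x : G i) (a : A) :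
    Commute (D.twist i l k hil hik hkl.symm x) (D.twist l j k' hjl.symm hlk' hjk' (D.s l a)) := by
  refine Subtype.ext (funext fun c => ?_)
  simp only [Subgroup.coe_mul, Pi.mul_apply, coe_twist_s]
  simp only [coe_twist]
  by_cases hl : c = l
  · subst hl
    simp only [Pi.mulSingle_eq_same, Pi.mulSingle_eq_of_ne hil.symm, Pi.mulSingle_eq_of_ne hjl.symm,
        Pi.mulSingle_eq_of_ne hkl.symm, one_mul, mul_one]
    exact D.commute_s _ _ _
  by_cases hj : c = j
  · subst hj
    simp [Pi.mulSingle_eq_of_ne hij.symm, Pi.mulSingle_eq_of_ne hjl, Pi.mulSingle_eq_of_ne hjk]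
  · simp [Pi.mulSingle_eq_of_ne hj, Pi.mulSingle_eq_of_ne hl]

/-- The second factor cancels the `A`-correction in coordinate `l` and puts it into coordinate `j`.
The choice of `k'` is immaterial, since section values over `A` have trivial `B`-part. -/
theorem twist_eq_mul_twist_s {k' : Fin 4} (hlk' : l ≠ k') (hjk' : j ≠ k') (x : G i) :
    D.twist i j k hij hik hjk x = D.twist i l k hil hik hkl.symm x *
      D.twist l j k' hjl.symm hlk' hjk' (D.s l (D.α i x)) := by
  refine Subtype.ext (funext fun c => ?_)
  simp only [Subgroup.coe_mul, Pi.mul_apply, coe_twist_s]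
  simp only [coe_twist]
  by_cases hl : c = l
  · subst hl
    simp [Pi.mulSingle_eq_of_ne hil.symm, Pi.mulSingle_eq_of_ne hjl.symm,
        Pi.mulSingle_eq_of_ne hkl.symm]
  by_cases hj : c = j
  · subst hj
    simp [Pi.mulSingle_eq_of_ne hij.symm, Pi.mulSingle_eq_of_ne hjl, Pi.mulSingle_eq_of_ne hjk]
  · simp [Pi.mulSingle_eq_of_ne hj, Pi.mulSingle_eq_of_ne hl]

include hjk hik in
theorem twist_commute_t {j' : Fin 4} (hlj' : l ≠ j') (hjk' : j' ≠ k) (x : G i) (b : B) :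
    Commute (D.twist i j l hij hil hjl x) (D.twist l j' k hlj' hkl.symm hjk' (D.t l b)) := by
  refine Subtype.ext (funext fun c => ?_)
  simp only [Subgroup.coe_mul, Pi.mul_apply, coe_twist_t]
  simp only [coe_twist]
  by_cases hl : c = l
  · subst hl
    simp only [Pi.mulSingle_eq_same, Pi.mulSingle_eq_of_ne hil.symm, Pi.mulSingle_eq_of_ne hjl.symm,
        Pi.mulSingle_eq_of_ne hkl.symm, one_mul, mul_one]
    exact D.commute_t _ _ _
  by_cases hk : c = k
  · subst hk
    simp [Pi.mulSingle_eq_of_ne hik.symm, Pi.mulSingle_eq_of_ne hl, Pi.mulSingle_eq_of_ne hjk.symm]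
  · simp [Pi.mulSingle_eq_of_ne hk, Pi.mulSingle_eq_of_ne hl]

/-- The mirror image of `twist_eq_mul_twist_s`: the `B`-correction moves from coordinate `l` to
coordinate `k`. -/
theorem twist_eq_mul_twist_t {j' : Fin 4} (hlj' : l ≠ j') (hjk' : j' ≠ k) (x : G i) :
    D.twist i j k hij hik hjk x = D.twist i j l hij hil hjl x *
      D.twist l j' k hlj' hkl.symm hjk' (D.t l (D.β i x)) := by
  refine Subtype.ext (funext fun c => ?_)
  simp only [Subgroup.coe_mul, Pi.mul_apply, coe_twist_t]
  simp only [coe_twist]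
  by_cases hl : c = l
  · subst hl
    simp [Pi.mulSingle_eq_of_ne hil.symm, Pi.mulSingle_eq_of_ne hjl.symm,
        Pi.mulSingle_eq_of_ne hkl.symm]
  by_cases hk : c = k
  · subst hk
    simp [Pi.mulSingle_eq_of_ne hik.symm, Pi.mulSingle_eq_of_ne hl, Pi.mulSingle_eq_of_ne hjk.symm]
  · simp [Pi.mulSingle_eq_of_ne hk, Pi.mulSingle_eq_of_ne hl]

end BiSplitting

/-! ### Filling words by repeated bisection -/

section Dyadic

/-- The solution of the recursion for filling a word by iterated bisection. -/
def dyadicSum (c : ℕ → ℕ) : ℕ → ℕ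
  | 0 => 1
  | j + 1 => 2 * dyadicSum c j + c (2 ^ j)

/-- If triangles of normal forms have fillings of area at most `c`, then so do all relations, up to
summation over dyadic scales. -/
theorem exists_presentation_of_triangle {K : Type*} [Group K] {k : ℕ} {π : FreeGroup (Fin k) →* K}
    (hπ : Function.Surjective π) (ω : K → FreeGroup (Fin k)) (hω : ∀ g, π (ω g) = g)
    {R : Set (FreeGroup (Fin k))} (hR : R.Finite) (hR1 : ∀ r ∈ R, π r = 1) (c : ℕ → ℕ)
    (h : ∀ N v w, v.norm ≤ N → w.norm ≤ N →
      AreaLE R (c N) (ω (π v) * ω (π w) * (ω (π v * π w))⁻¹)) :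
    ∃ Q : FinitePresentation K, ∀ j, Q.dehn (2 ^ j) ≤ dyadicSum c j + 1 := by
  -- These relators identify each letter with its normal form. The empty word is included in order
  -- to fill `ω 1`, which accounts for the final `+ 1`.
  let S : Set (FreeGroup (Fin k)) :=
    (fun L => FreeGroup.mk L * (ω (π (FreeGroup.mk L)))⁻¹) ''
      {L : List (Fin k × Bool) | L.length ≤ 1}
  have hS : S.Finite := (List.finite_length_le _ 1).image _
  have hS1 : ∀ r ∈ S, π r = 1 := by
    rintro _ ⟨L, -, rfl⟩
    simp [hω]
  have key : ∀ j (L : List (Fin k × Bool)), L.length ≤ 2 ^ j →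
      Close (R ∪ S) (dyadicSum c j) (FreeGroup.mk L) (ω (π (FreeGroup.mk L))) := by
    intro j
    induction j with
    | zero => exact fun L hL => AreaLE.of_mem (Or.inr ⟨L, by simpa using hL, rfl⟩)
    | succ j ih =>
      intro L hL
      have hv : (L.take (2 ^ j)).length ≤ 2 ^ j := by simp
      have hw : (L.drop (2 ^ j)).length ≤ 2 ^ j := by
        rw [List.length_drop]; rw [pow_succ] at hL; omega
      have e1 := (ih _ hv).mul (ih _ hw)
      have e2 : Close (R ∪ S) (c (2 ^ j)) _ _ := (h (2 ^ j) _ _ (FreeGroup.norm_mk_le.trans hv)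
        (FreeGroup.norm_mk_le.trans hw)).mono Set.subset_union_left le_rfl
      have e3 := e1.trans e2
      rw [← map_mul, FreeGroup.mul_mk, List.take_append_drop] at e3
      exact e3.mono_right (by rw [dyadicSum]; omega)
  have key' : ∀ j w, π w = 1 → w.norm ≤ 2 ^ j → AreaLE (R ∪ S) (dyadicSum c j + 1) w := by
    intro j w hw hj
    have e := key j w.toWord hj
    rw [FreeGroup.mk_toWord, hw] at e
    refine e.areaLE ?_
    have : AreaLE (R ∪ S) 1 (1 * (ω 1)⁻¹) :=
      AreaLE.of_mem (Or.inr ⟨[], by simp, by simp only [← FreeGroup.one_eq_mk, map_one]⟩)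
    simpa using this.inv
  have hRS1 : ∀ r ∈ R ∪ S, π r = 1 := by
    rintro r (hr | hr)
    exacts [hR1 r hr, hS1 r hr]
  exact ⟨.ofAreaLE π hπ (R ∪ S) (hR.union hS) hRS1
    fun w hw => ⟨_, key' _ w hw w.norm.lt_two_pow_self.le⟩,
    fun j => FinitePresentation.dehn_le _ fun w hw hn => key' j w hw hn⟩

end Dyadic

/-! ### Normal forms in the kernel and their triangles -/

namespace BiSplitting

variable {G : Fin 4 → Type*} [∀ i, Group (G i)] {A B : Type*} [CommGroup A] [CommGroup B]
  (D : BiSplitting G A B)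

/-- The inserted section values undo the corrections made in coordinates `0` and `1` by the last two
twists. The corrections made by the first two twists in coordinates `2` and `3` cancel because both
total parts of `g` are trivial. -/
theorem eq_prod_twist (g : D.kernel) :
    D.twist 0 2 3 (by decide) (by decide) (by decide)
      (g.1 0 * D.s 0 (D.α 2 (g.1 2) * D.α 3 (g.1 3))) *
    D.twist 1 2 3 (by decide) (by decide) (by decide)
      (g.1 1 * D.t 1 (D.β 2 (g.1 2) * D.β 3 (g.1 3))) *
    D.twist 2 0 1 (by decide) (by decide) (by decide) (g.1 2) *
    D.twist 3 0 1 (by decide) (by decide) (by decide) (g.1 3) = g := by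
  obtain ⟨hα, hβ⟩ := D.mem_kernel.1 g.2
  rw [totalα_apply, Fin.prod_univ_four] at hα
  rw [totalβ_apply, Fin.prod_univ_four] at hβ
  refine Subtype.ext (funext fun c => ?_)
  simp only [Subgroup.coe_mul, Pi.mul_apply, coe_twist]
  fin_cases c
  · simp only [Fin.zero_eta, Fin.isValue, Pi.mulSingle_eq_same, ne_eq, zero_ne_one,
      not_false_eq_true, Pi.mulSingle_eq_of_ne, Fin.reduceEq, mul_one, one_mul, mul_assoc,
      ← map_mul]
    simp [mul_comm, mul_left_comm]
  · simp only [Fin.mk_one, Fin.isValue, Pi.mulSingle_eq_same, ne_eq, one_ne_zero,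
      not_false_eq_true, Pi.mulSingle_eq_of_ne, Fin.reduceEq, mul_one, one_mul, mul_assoc,
      ← map_mul]
    simp [mul_comm, mul_left_comm]
  · have e : (D.α 0 (g.1 0 * D.s 0 (D.α 2 (g.1 2) * D.α 3 (g.1 3))))⁻¹ *
        (D.α 1 (g.1 1 * D.t 1 (D.β 2 (g.1 2) * D.β 3 (g.1 3))))⁻¹ = 1 := by
      rw [map_mul (D.α 0), map_mul (D.α 1), D.α_s, D.α_t, mul_one, ← mul_inv, inv_eq_one, ← hα]
      simp only [mul_assoc, mul_comm, mul_left_comm]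
    simp only [Fin.reduceFinMk, Fin.isValue, Pi.mulSingle_eq_same, ne_eq, not_false_eq_true,
      Pi.mulSingle_eq_of_ne, Fin.reduceEq, mul_one, one_mul]
    rw [← map_mul (D.s 2), e, map_one, one_mul]
  · have e : (D.β 0 (g.1 0 * D.s 0 (D.α 2 (g.1 2) * D.α 3 (g.1 3))))⁻¹ *
        (D.β 1 (g.1 1 * D.t 1 (D.β 2 (g.1 2) * D.β 3 (g.1 3))))⁻¹ = 1 := by
      rw [map_mul (D.β 0), map_mul (D.β 1), D.β_s, D.β_t, mul_one, ← mul_inv, inv_eq_one, ← hβ]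
      simp only [mul_assoc]
    simp only [Fin.reduceFinMk, Fin.isValue, Pi.mulSingle_eq_same, ne_eq, not_false_eq_true,
      Pi.mulSingle_eq_of_ne, Fin.reduceEq, mul_one, one_mul]
    rw [← map_mul (D.t 3), e, map_one, one_mul]

theorem exists_surjective_freeGroup (P : ∀ i, FinitePresentation (G i)) :
    ∃ (k : ℕ) (π : FreeGroup (Fin k) →* D.kernel), Function.Surjective π := by
  let σ : ∀ i, G i →* D.kernel := fun i => match i with
    | 0 => D.twist 0 2 3 (by decide) (by decide) (by decide)
    | 1 => D.twist 1 2 3 (by decide) (by decide) (by decide)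
    | 2 => D.twist 2 0 1 (by decide) (by decide) (by decide)
    | 3 => D.twist 3 0 1 (by decide) (by decide) (by decide)
  let Φ : FreeGroup (Σ i, Fin (P i).numGens) →* D.kernel :=
    FreeGroup.lift fun z => σ z.1 ((P z.1).π (FreeGroup.of z.2))
  have hΦ : ∀ i (x : G i), σ i x ∈ Φ.range := by
    intro i x
    obtain ⟨w, rfl⟩ := (P i).surjective x
    refine ⟨FreeGroup.map (Sigma.mk i) w, ?_⟩
    have : Φ.comp (FreeGroup.map (Sigma.mk i)) = (σ i).comp (P i).π := by
      ext; simp [Φ]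
    exact DFunLike.congr_fun this w
  have hs : Function.Surjective Φ := by
    intro g
    rw [← MonoidHom.mem_range, ← D.eq_prod_twist g]
    exact mul_mem (mul_mem (mul_mem (hΦ 0 _) (hΦ 1 _)) (hΦ 2 _)) (hΦ 3 _)
  let e := (Fintype.equivFin (Σ i, Fin (P i).numGens)).symm
  exact ⟨_, Φ.comp (FreeGroup.map e), hs.comp (FreeGroup.map_surjective e.surjective)⟩

variable {H : ℕ →o ℕ} (hsq : ∀ m, m ^ 2 ≤ H m) (hG : ∀ i, DehnDominated H (G i)) {m : ℕ}
  {π : FreeGroup (Fin m) →* D.kernel} (hπ : Function.Surjective π) {I : Type*} {n : I → ℕ}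

/-- A normal form for elements of the kernel. -/
noncomputable def normalForm (g : D.kernel) : FreeGroup (Fin m) :=
  wordLift hπ (hG 0) (D.twist 0 2 3 (by decide) (by decide) (by decide))
    (g.1 0 * D.s 0 (D.α 2 (g.1 2) * D.α 3 (g.1 3))) *
  wordLift hπ (hG 1) (D.twist 1 2 3 (by decide) (by decide) (by decide))
    (g.1 1 * D.t 1 (D.β 2 (g.1 2) * D.β 3 (g.1 3))) *
  wordLift hπ (hG 2) (D.twist 2 0 1 (by decide) (by decide) (by decide)) (g.1 2) *
  wordLift hπ (hG 3) (D.twist 3 0 1 (by decide) (by decide) (by decide)) (g.1 3)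

theorem map_normalForm (g : D.kernel) : π (D.normalForm hG hπ g) = g := by
  rw [normalForm, map_mul, map_mul, map_mul]
  simp only [map_wordLift]
  exact D.eq_prod_twist g

variable (n) in
/-- The homomorphism on linear families induced by `twist`. -/
noncomputable def twistFamily (i j k : Fin 4) (hij : i ≠ j) (hik : i ≠ k) (hjk : j ≠ k) :
    linearFamilies n (G i) →* (I → FreeGroup (Fin m)) ⧸ negligible n H π :=
  familyHom hπ (hG i) (D.twist i j k hij hik hjk)

section

variable {i j k l : Fin 4} (hij : i ≠ j) (hik : i ≠ k) (hil : i ≠ l) (hjk : j ≠ k) (hjl : j ≠ l)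
  (hkl : k ≠ l)

include hsq hil in
theorem twistFamily_commute (x : linearFamilies n (G i)) (y : linearFamilies n (G l)) :
    Commute (D.twistFamily hG hπ n i j k hij hik hjk x)
      (D.twistFamily hG hπ n l j k hjl.symm hkl.symm hjk y) :=
  familyHom_commute hsq hπ (hG i) (hG l) _ _ (D.twist_commute hij hik hil hjk hjl hkl) x y

include hsq in
theorem twistFamily_eq_mul_s {k' : Fin 4} (hlk' : l ≠ k') (hjk' : j ≠ k')
    (x : linearFamilies n (G i)) :
    D.twistFamily hG hπ n i j k hij hik hjk x = D.twistFamily hG hπ n i l k hil hik hkl.symm x *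
      D.twistFamily hG hπ n l j k' hjl.symm hlk' hjk'
        (linearFamilies.map (D.s l) (linearFamilies.map (D.α i) x)) :=
  familyHom_mul hsq hπ (hG i) (hG l) _ _ _ ((D.s l).comp (D.α i))
    (fun x y => D.twist_commute_s hij hik hil hjk hjl hkl hlk' hjk' x (D.α i y))
    (D.twist_eq_mul_twist_s hij hik hil hjk hjl hkl hlk' hjk') x

include hsq in
theorem twistFamily_eq_mul_t {j' : Fin 4} (hlj' : l ≠ j') (hjk' : j' ≠ k)
    (x : linearFamilies n (G i)) :
    D.twistFamily hG hπ n i j k hij hik hjk x = D.twistFamily hG hπ n i j l hij hil hjl x *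
      D.twistFamily hG hπ n l j' k hlj' hkl.symm hjk'
        (linearFamilies.map (D.t l) (linearFamilies.map (D.β i) x)) :=
  familyHom_mul hsq hπ (hG i) (hG l) _ _ _ ((D.t l).comp (D.β i))
    (fun x y => D.twist_commute_t hij hik hil hjk hjl hkl hlj' hjk' x (D.β i y))
    (D.twist_eq_mul_twist_t hij hik hil hjk hjl hkl hlj' hjk') x

end

/-- The coordinate projections on linear families. -/
def projFamily (i : Fin 4) : linearFamilies n D.kernel →* linearFamilies n (G i) :=
  linearFamilies.map ((Pi.evalMonoidHom G i).comp D.kernel.subtype)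

include hsq in
/-- Triangles of normal forms have negligible area. -/
theorem triangle_mem_negligible (p q : linearFamilies n D.kernel) :
    (fun i => D.normalForm hG hπ (p.1 i) * D.normalForm hG hπ (q.1 i) *
      (D.normalForm hG hπ (p.1 i * q.1 i))⁻¹) ∈ negligible n H π := by
  -- The `A`-corrections of factors `0` and `1` are moved out of coordinate `2`, where the acting
  -- element `g` itself sits.
  have h3 := conj_of_swap
    (σ₁ := D.twistFamily hG hπ n 0 2 3 (by decide) (by decide) (by decide))
    (σ₁' := D.twistFamily hG hπ n 0 1 3 (by decide) (by decide) (by decide))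
    (σ₂ := D.twistFamily hG hπ n 1 2 3 (by decide) (by decide) (by decide))
    (σ₂' := D.twistFamily hG hπ n 1 0 3 (by decide) (by decide) (by decide))
    (σ₃ := D.twistFamily hG hπ n 2 0 1 (by decide) (by decide) (by decide))
    (σ₃' := D.twistFamily hG hπ n 2 0 3 (by decide) (by decide) (by decide))
    (σ₃'' := D.twistFamily hG hπ n 2 1 3 (by decide) (by decide) (by decide))
    (α₁ := linearFamilies.map (D.α 0)) (α₂ := linearFamilies.map (D.α 1))
    (α₃ := linearFamilies.map (D.α 2)) (β₃ := linearFamilies.map (D.β 2))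
    (s₁ := linearFamilies.map (D.s 0)) (s₂ := linearFamilies.map (D.s 1))
    (t₂ := linearFamilies.map (D.t 1))
    (fun a => Subtype.ext (funext fun i => D.α_s 1 (a.1 i)))
    (D.twistFamily_eq_mul_s hsq hG hπ (by decide) (by decide) (by decide) (by decide) (by decide)
      (by decide) (by decide) (by decide))
    (D.twistFamily_eq_mul_s hsq hG hπ (by decide) (by decide) (by decide) (by decide) (by decide)
      (by decide) (by decide) (by decide))
    (D.twistFamily_eq_mul_t hsq hG hπ (by decide) (by decide) (by decide) (by decide) (by decide)
      (by decide) (by decide) (by decide))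
    (D.twistFamily_eq_mul_s hsq hG hπ (by decide) (by decide) (by decide) (by decide) (by decide)
      (by decide) (by decide) (by decide))
    (D.twistFamily_commute hsq hG hπ _ _ (by decide) _ (by decide) (by decide))
    (D.twistFamily_commute hsq hG hπ _ _ (by decide) _ (by decide) (by decide))
    (D.twistFamily_commute hsq hG hπ _ _ (by decide) _ (by decide) (by decide))
  -- The same computation under the symmetry exchanging `A` with `B`, `0` with `1` and `2` with `3`.
  have h4 := conj_of_swap
    (σ₁ := D.twistFamily hG hπ n 1 2 3 (by decide) (by decide) (by decide))
    (σ₁' := D.twistFamily hG hπ n 1 2 0 (by decide) (by decide) (by decide))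
    (σ₂ := D.twistFamily hG hπ n 0 2 3 (by decide) (by decide) (by decide))
    (σ₂' := D.twistFamily hG hπ n 0 2 1 (by decide) (by decide) (by decide))
    (σ₃ := D.twistFamily hG hπ n 3 0 1 (by decide) (by decide) (by decide))
    (σ₃' := D.twistFamily hG hπ n 3 2 1 (by decide) (by decide) (by decide))
    (σ₃'' := D.twistFamily hG hπ n 3 2 0 (by decide) (by decide) (by decide))
    (α₁ := linearFamilies.map (D.β 1)) (α₂ := linearFamilies.map (D.β 0))
    (α₃ := linearFamilies.map (D.β 3)) (β₃ := linearFamilies.map (D.α 3))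
    (s₁ := linearFamilies.map (D.t 1)) (s₂ := linearFamilies.map (D.t 0))
    (t₂ := linearFamilies.map (D.s 0))
    (fun a => Subtype.ext (funext fun i => D.β_t 0 (a.1 i)))
    (D.twistFamily_eq_mul_t hsq hG hπ (by decide) (by decide) (by decide) (by decide) (by decide)
      (by decide) (by decide) (by decide))
    (D.twistFamily_eq_mul_t hsq hG hπ (by decide) (by decide) (by decide) (by decide) (by decide)
      (by decide) (by decide) (by decide))
    (D.twistFamily_eq_mul_s hsq hG hπ (by decide) (by decide) (by decide) (by decide) (by decide)
      (by decide) (by decide) (by decide))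
    (D.twistFamily_eq_mul_t hsq hG hπ (by decide) (by decide) (by decide) (by decide) (by decide)
      (by decide) (by decide) (by decide))
    (D.twistFamily_commute hsq hG hπ _ _ (by decide) _ (by decide) (by decide))
    (D.twistFamily_commute hsq hG hπ _ _ (by decide) _ (by decide) (by decide))
    (D.twistFamily_commute hsq hG hπ _ _ (by decide) _ (by decide) (by decide))
  have c01 := D.twistFamily_commute (n := n) hsq hG hπ (i := 0) (j := 2) (k := 3) (l := 1)
    (by decide) (by decide) (by decide) (by decide) (by decide) (by decide)
  have c23 := D.twistFamily_commute (n := n) hsq hG hπ (i := 2) (j := 0) (k := 1) (l := 3)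
    (by decide) (by decide) (by decide) (by decide) (by decide) (by decide)
  have key := normalForm_mul
    (α₁ := linearFamilies.map (n := n) (D.α 0)) (α₂ := linearFamilies.map (D.α 1))
    (α₃ := linearFamilies.map (D.α 2)) (α₄ := linearFamilies.map (D.α 3))
    (β₁ := linearFamilies.map (n := n) (D.β 0)) (β₂ := linearFamilies.map (D.β 1))
    (β₃ := linearFamilies.map (D.β 2)) (β₄ := linearFamilies.map (D.β 3))
    (s := linearFamilies.map (D.s 0)) (t := linearFamilies.map (D.t 1))
    (fun a => Subtype.ext (funext fun i => D.α_s 0 (a.1 i)))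
    (fun a => Subtype.ext (funext fun i => D.β_s 0 (a.1 i)))
    (fun a => Subtype.ext (funext fun i => D.β_t 1 (a.1 i)))
    (fun a => Subtype.ext (funext fun i => D.α_t 1 (a.1 i)))
    c01 c23 h3
    -- By the symmetry, `h4` has factors `1` and `0` in reversed order; `c01` restores it on both
    -- sides.
    (fun g x y hxy => by
      have := h4 g y x (by rw [mul_comm]; exact hxy)
      rw [← (c01 x y).eq] at this
      rw [this, (c01 _ _).eq])
    (D.projFamily 0 p) (D.projFamily 0 q) (D.projFamily 1 p) (D.projFamily 1 q)
    (D.projFamily 2 p) (D.projFamily 2 q) (D.projFamily 3 p) (D.projFamily 3 q)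
    (Subtype.ext (funext fun i => by
      have := (D.mem_kernel.1 (q.1 i).2).1
      rwa [totalα_apply, Fin.prod_univ_four] at this))
    (Subtype.ext (funext fun i => by
      have := (D.mem_kernel.1 (q.1 i).2).2
      rwa [totalβ_apply, Fin.prod_univ_four] at this))
  have key' : ((fun i => D.normalForm hG hπ (p.1 i) * D.normalForm hG hπ (q.1 i) :
      I → FreeGroup (Fin m)) : (I → FreeGroup (Fin m)) ⧸ negligible n H π) =
      (fun i => D.normalForm hG hπ (p.1 i * q.1 i) : I → FreeGroup (Fin m)) := key
  rw [QuotientGroup.eq_iff_div_mem, div_eq_mul_inv] at key'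
  exact key'

include hsq hG in
/-- The kernel is finitely presented, with Dehn function bounded by a sum over dyadic scales. -/
theorem exists_presentation : ∃ (Q : FinitePresentation D.kernel) (C : ℕ),
    ∀ j, Q.dehn (2 ^ j) ≤ dyadicSum (fun N => C * H (C * (N + 1))) j + 1 := by
  obtain ⟨m, π, hπ⟩ := D.exists_surjective_freeGroup fun i => (hG i).choose
  -- The index set consists of all pairs of words, so one negligible family bounds all triangles at
  -- once, with uniform constants. For words of length at most `N` the parameter is at most `2 * N`,
  -- whence the constant `2 * C` below.
  let n : FreeGroup (Fin m) × FreeGroup (Fin m) → ℕ := fun z => z.1.norm + z.2.norm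
  obtain ⟨R, hR, hR1, C, hC⟩ := D.triangle_mem_negligible (n := n) hsq hG hπ
    ⟨_, mem_linearFamilies_of_norm_le π (w := Prod.fst) (C := 1) fun z => by
      simp only [n]; omega⟩
    ⟨_, mem_linearFamilies_of_norm_le π (w := Prod.snd) (C := 1) fun z => by
      simp only [n]; omega⟩
  obtain ⟨Q, hQ⟩ := exists_presentation_of_triangle hπ (D.normalForm hG hπ) (D.map_normalForm hG hπ)
    hR hR1 (fun N => 2 * C * H (2 * C * (N + 1))) (fun N v w hv hw => by
      refine (hC (v, w)).mono_right (Nat.mul_le_mul (by omega) (H.monotone ?_))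
      rw [mul_comm 2 C, mul_assoc]
      exact Nat.mul_le_mul_left _ (by simp only [n]; omega))
  exact ⟨Q, 2 * C, hQ⟩

end BiSplitting

/-! ### Quadratic lower bounds from the Heisenberg group -/

section Heisenberg

/-- The integral Heisenberg group. -/
@[ext]
structure Heisenberg where
  x : ℤ
  y : ℤ
  z : ℤ

namespace Heisenberg

instance : Mul Heisenberg := ⟨fun g h => ⟨g.x + h.x, g.y + h.y, g.z + h.z + g.x * h.y⟩⟩
instance : One Heisenberg := ⟨⟨0, 0, 0⟩⟩
instance : Inv Heisenberg := ⟨fun g => ⟨-g.x, -g.y, -g.z + g.x * g.y⟩⟩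

@[simp] theorem mul_x (g h : Heisenberg) : (g * h).x = g.x + h.x := rfl
@[simp] theorem mul_y (g h : Heisenberg) : (g * h).y = g.y + h.y := rfl
@[simp] theorem mul_z (g h : Heisenberg) : (g * h).z = g.z + h.z + g.x * h.y := rfl
@[simp] theorem one_x : (1 : Heisenberg).x = 0 := rfl
@[simp] theorem one_y : (1 : Heisenberg).y = 0 := rfl
@[simp] theorem one_z : (1 : Heisenberg).z = 0 := rfl
@[simp] theorem inv_x (g : Heisenberg) : (g⁻¹).x = -g.x := rfl
@[simp] theorem inv_y (g : Heisenberg) : (g⁻¹).y = -g.y := rfl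
@[simp] theorem inv_z (g : Heisenberg) : (g⁻¹).z = -g.z + g.x * g.y := rfl

instance : Group Heisenberg := Group.ofLeftAxioms
  (fun a b c => by ext <;> simp <;> ring) (fun a => by ext <;> simp)
  (fun a => by ext <;> simp)

theorem pow_of_y_eq_zero {g : Heisenberg} (hg : g.y = 0) (n : ℕ) :
    (g ^ n).x = n * g.x ∧ (g ^ n).y = 0 := by
  induction n with
  | zero => simp
  | succ n ih =>
    rw [pow_succ]
    refine ⟨?_, by simp [ih.2, hg]⟩
    rw [mul_x, ih.1]; push_cast; ring

theorem pow_of_x_eq_zero {g : Heisenberg} (hg : g.x = 0) (n : ℕ) :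
    (g ^ n).x = 0 ∧ (g ^ n).y = n * g.y := by
  induction n with
  | zero => simp
  | succ n ih =>
    rw [pow_succ]
    refine ⟨by simp [ih.1, hg], ?_⟩
    rw [mul_y, ih.2]; push_cast; ring

/-- The first coordinate. -/
def xHom : Heisenberg →* Multiplicative ℤ where
  toFun g := Multiplicative.ofAdd g.x
  map_one' := rfl
  map_mul' _ _ := rfl

/-- The second coordinate. -/
def yHom : Heisenberg →* Multiplicative ℤ where
  toFun g := Multiplicative.ofAdd g.y
  map_one' := rfl
  map_mul' _ _ := rfl

/-- The central coordinate bounds the area from below. -/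
theorem abs_z_le_of_areaLE {F : Type*} [Group F] (Ψ : F →* Heisenberg) {R : Set F} {M : ℤ}
    (hR : ∀ r ∈ R, (Ψ r).x = 0 ∧ (Ψ r).y = 0 ∧ |(Ψ r).z| ≤ M) {c : ℕ} {w : F}
    (hw : AreaLE R c w) (hM : 0 ≤ M) : |(Ψ w).z| ≤ c * M := by
  obtain ⟨L, h1, h2, rfl⟩ := hw
  suffices H : (Ψ L.prod).x = 0 ∧ (Ψ L.prod).y = 0 ∧ |(Ψ L.prod).z| ≤ L.length * M from
    H.2.2.trans (by gcongr)
  clear h1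
  induction L with
  | nil => simp
  | cons a L ih =>
    obtain ⟨i1, i2, i3⟩ := ih fun g hg => h2 g (by simp [hg])
    obtain ⟨u, r, hr, rfl⟩ := h2 a (by simp)
    have hr' : (Ψ r).x = 0 ∧ (Ψ r).y = 0 ∧ |(Ψ r).z| ≤ M := by
      rcases hr with hr | hr
      · exact hR r hr
      · obtain ⟨k1, k2, k3⟩ := hR _ hr
        simp only [map_inv, inv_x, inv_y, inv_z, neg_eq_zero] at k1 k2 k3
        refine ⟨k1, k2, ?_⟩
        rw [k1, zero_mul, add_zero, abs_neg] at k3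
        exact k3
    obtain ⟨k1, k2, k3⟩ := hr'
    -- `Ψ r` is central, so conjugation does not change it.
    have hz : (Ψ (u * r * u⁻¹)).z = (Ψ r).z := by
      simp only [map_mul, map_inv, mul_z, mul_x, inv_z, inv_y, k1, k2]
      ring
    refine ⟨by simp [k1, i1], by simp [k2, i2], ?_⟩
    rw [List.prod_cons, map_mul, mul_z, i2, mul_zero, add_zero, hz]
    refine (abs_add_le _ _).trans ?_
    push_cast [List.length_cons]
    linarith

end Heisenberg

theorem FreeGroup.norm_pow_le {X : Type*} [DecidableEq X] (w : FreeGroup X) (n : ℕ) :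
    (w ^ n).norm ≤ n * w.norm := by
  induction n with
  | zero => simp
  | succ n ih =>
    rw [pow_succ, add_mul, one_mul]
    exact (FreeGroup.norm_mul_le _ _).trans (by omega)

/-- A group containing a copy of `ℤ²` which is detected by homomorphisms to `ℤ` has at least
quadratic Dehn function. -/
theorem FinitePresentation.exists_sq_le_dehn {Γ : Type*} [Group Γ] (P : FinitePresentation Γ)
    (χ₁ χ₂ : Γ →* Multiplicative ℤ) {u v : Γ} (huv : Commute u v) {c : ℤ} (hc : c ≠ 0)
    (h₁u : χ₁ u = Multiplicative.ofAdd c) (h₁v : χ₁ v = 1) (h₂u : χ₂ u = 1)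
    (h₂v : χ₂ v = Multiplicative.ofAdd c) : ∃ C : ℕ, ∀ n, n ^ 2 ≤ C * P.dehn (C * n) := by
  -- A lift of `(χ₁, χ₂)` from `ℤ²` to the Heisenberg group. It need not factor through `Γ`, but it
  -- sends relators to the centre, so the central coordinate of a relation measures area.
  let Ψ : FreeGroup (Fin P.numGens) →* Heisenberg := FreeGroup.lift fun i =>
    ⟨(χ₁ (P.π (FreeGroup.of i))).toAdd, (χ₂ (P.π (FreeGroup.of i))).toAdd, 0⟩
  have hx : ∀ w, (Ψ w).x = (χ₁ (P.π w)).toAdd := by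
    intro w
    have : Heisenberg.xHom.comp Ψ = χ₁.comp P.π := by
      ext i
      simp [Ψ, Heisenberg.xHom]
    exact congrArg Multiplicative.toAdd (DFunLike.congr_fun this w)
  have hy : ∀ w, (Ψ w).y = (χ₂ (P.π w)).toAdd := by
    intro w
    have : Heisenberg.yHom.comp Ψ = χ₂.comp P.π := by
      ext i
      simp [Ψ, Heisenberg.yHom]
    exact congrArg Multiplicative.toAdd (DFunLike.congr_fun this w)
  obtain ⟨M, hM⟩ := (P.finite_rels.image fun r => |(Ψ r).z|).bddAbove
  obtain ⟨U, rfl⟩ := P.surjective u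
  obtain ⟨V, rfl⟩ := P.surjective v
  -- The first summand bounds the central coordinate of a relator, the second bounds the length of
  -- the commutator of `U ^ n` and `V ^ n` divided by `n`.
  refine ⟨M.toNat + 2 * (U.norm + V.norm), fun n => ?_⟩
  have hw1 : P.π (U ^ n * V ^ n * (U ^ n)⁻¹ * (V ^ n)⁻¹) = 1 := by
    have := (huv.pow_pow n n).eq
    simp only [map_mul, map_pow, map_inv]
    rw [this]; group
  have hn : (U ^ n * V ^ n * (U ^ n)⁻¹ * (V ^ n)⁻¹).norm ≤
      (M.toNat + 2 * (U.norm + V.norm)) * n := by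
    have a1 := FreeGroup.norm_mul_le (U ^ n * V ^ n * (U ^ n)⁻¹) (V ^ n)⁻¹
    have a2 := FreeGroup.norm_mul_le (U ^ n * V ^ n) (U ^ n)⁻¹
    have a3 := FreeGroup.norm_mul_le (U ^ n) (V ^ n)
    have a4 := FreeGroup.norm_pow_le U n
    have a5 := FreeGroup.norm_pow_le V n
    rw [FreeGroup.norm_inv_eq] at a1 a2
    nlinarith [Nat.zero_le (M.toNat * n)]
  have key := Heisenberg.abs_z_le_of_areaLE Ψ (M := M.toNat)
    (fun r hr => ⟨by simp [hx, P.map_rels hr], by simp [hy, P.map_rels hr],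
      (hM ⟨r, hr, rfl⟩).trans (Int.self_le_toNat M)⟩) (P.areaLE_dehn hw1 hn) (by positivity)
  obtain ⟨b1, b2⟩ := Heisenberg.pow_of_y_eq_zero (g := Ψ U) (by rw [hy, h₂u]; rfl) n
  obtain ⟨b3, b4⟩ := Heisenberg.pow_of_x_eq_zero (g := Ψ V) (by rw [hx, h₁v]; rfl) n
  have hz : (Ψ (U ^ n * V ^ n * (U ^ n)⁻¹ * (V ^ n)⁻¹)).z = (n * c) * (n * c) := by
    simp only [map_mul, map_inv, map_pow, Heisenberg.mul_z, Heisenberg.inv_z, Heisenberg.mul_x,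
      Heisenberg.inv_x, Heisenberg.inv_y, b1, b2, b3, b4, hx, hy, h₁u, h₂v, toAdd_ofAdd]
    ring
  have h1 : (1 : ℤ) ≤ c * c := by
    have := mul_self_pos.2 hc
    omega
  have h2 : ((n : ℤ)) ^ 2 ≤ P.dehn ((M.toNat + 2 * (U.norm + V.norm)) * n) * M.toNat := by
    refine le_trans ?_ key
    rw [hz]
    refine le_trans ?_ (le_abs_self _)
    nlinarith [sq_nonneg (n : ℤ)]
  have h3 : n ^ 2 ≤ P.dehn ((M.toNat + 2 * (U.norm + V.norm)) * n) * M.toNat := by exact_mod_cast h2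
  refine h3.trans ?_
  rw [mul_comm]
  gcongr
  omega

end Heisenberg

/-! ### Asymptotic estimates and the dyadic sum -/

section Asymptotics

theorem AsympLE.of_nat {a b : ℕ → ℕ} (hb : Monotone b) {C : ℕ}
    (h : ∀ n, a n ≤ C * b (C * n) + C * n) :
    AsympLE (fun n => (a n : ℝ)) (fun n => (b n : ℝ)) := by
  refine ⟨C + 1, by omega, fun n => ?_⟩
  have h1 : C * b (C * n) ≤ (C + 1) * b ((C + 1) * n + (C + 1)) :=
    Nat.mul_le_mul (by omega) (hb (by nlinarith))
  have h2 : a n ≤ (C + 1) * b ((C + 1) * n + (C + 1)) + (C + 1) * n + (C + 1) := by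
    have := h n
    nlinarith
  beta_reduce
  exact_mod_cast h2

theorem AsympLE.trans {f g h : ℕ → ℝ} (hfg : AsympLE f g) (hgh : AsympLE g h) (hh : Monotone h)
    (h0 : ∀ n, 0 ≤ h n) : AsympLE f h := by
  obtain ⟨C, hC, h1⟩ := hfg
  obtain ⟨D, hD, h2⟩ := hgh
  refine ⟨C * D * C + C * D + C + D, by omega, fun n => ?_⟩
  set E := C * D * C + C * D + C + D with hE
  have e1 := h1 n
  have e2 := h2 (C * n + C)
  have e3 : h (D * (C * n + C) + D) ≤ h (E * n + E) := hh (by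
    rw [hE]; nlinarith [Nat.zero_le (C * D * C), Nat.zero_le (C * D * C * n), Nat.zero_le (C * n),
      Nat.zero_le (D * n)])
  have hCr : (0 : ℝ) ≤ C := C.cast_nonneg
  have hDr : (0 : ℝ) ≤ D := D.cast_nonneg
  have e4 : (C : ℝ) * g (C * n + C) ≤
      C * (D * h (E * n + E) + D * (C * n + C : ℕ) + D) := by
    refine mul_le_mul_of_nonneg_left (e2.trans ?_) hCr
    gcongr
  push_cast at e4
  have hEr : (E : ℝ) = C * D * C + C * D + C + D := by rw [hE]; push_cast; ring
  have hn : (0 : ℝ) ≤ n := n.cast_nonneg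
  have e5 : (C * D : ℝ) * h (E * n + E) ≤ E * h (E * n + E) := by
    refine mul_le_mul_of_nonneg_right ?_ (h0 _)
    rw [hEr]; nlinarith [mul_nonneg (mul_nonneg hCr hDr) hCr]
  have e6 : (C * D * C + C : ℝ) * n ≤ E * n := by
    refine mul_le_mul_of_nonneg_right ?_ hn
    rw [hEr]; nlinarith [mul_nonneg hCr hDr]
  have e7 : (C * D * C + C * D + C : ℝ) ≤ E := by rw [hEr]; linarith
  linarith

/-- Absorbing linear terms into a function that is at least quadratic. -/
theorem exists_le_mul_of_sq_le {f : ℕ → ℝ} (hf : Monotone f) (h0 : ∀ n, 0 ≤ f n) {b : ℕ → ℕ}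
    (hsq : ∀ n, n ^ 2 ≤ b n) {C : ℕ}
    (h : ∀ n, (b n : ℝ) ≤ C * f (C * n + C) + C * n + C) :
    ∃ E : ℕ, ∀ n, 0 < n → (b n : ℝ) ≤ E * f (E * n) := by
  -- The hypothesis is used at `M * n` as well: for `n > 0` this `M` makes `(M * n) ^ 2` exceed the
  -- linear terms `2 * C * M * n` by at least `M * n`, so `n` itself is bounded by `C * f (E * n)`.
  set M := 2 * C + 1 with hM
  refine ⟨2 * C * M + C + 2 * C * C, fun n hn => ?_⟩
  have hn' : (1 : ℝ) ≤ n := by exact_mod_cast hn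
  have hCr : (0 : ℝ) ≤ C := C.cast_nonneg
  set E := 2 * C * M + C + 2 * C * C with hE
  have f1 : f (C * (M * n) + C) ≤ f (E * n) := hf (by
    rw [hE]
    have : C ≤ C * M * n := by
      rw [mul_assoc]; exact Nat.le_mul_of_pos_right _ (by positivity)
    nlinarith [Nat.zero_le (C * n), Nat.zero_le (C * C * n)])
  have f2 : f (C * n + C) ≤ f (E * n) := hf (by
    rw [hE, hM]
    have : C ≤ C * n := Nat.le_mul_of_pos_right _ hn
    nlinarith [Nat.zero_le (C * n), Nat.zero_le (C * C * n)])
  have s1 : (((M * n) ^ 2 : ℕ) : ℝ) ≤ b (M * n) := by exact_mod_cast hsq (M * n)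
  have s2 := s1.trans (h (M * n))
  have s3 : (C : ℝ) * f (C * (M * n) + C) ≤ C * f (E * n) := by gcongr
  have hMr : (M : ℝ) = 2 * C + 1 := by rw [hM]; push_cast; ring
  have hlin : (n : ℝ) ≤ C * f (E * n) := by
    push_cast at s2
    have q1 : (C : ℝ) ≤ C * (M * n) := by
      have : (1 : ℝ) ≤ M * n := by
        rw [hMr]; nlinarith
      nlinarith
    have q2 : (M : ℝ) * n ≤ (M * n) ^ 2 - 2 * (C * (M * n)) := by
      have : (M * n : ℝ) ^ 2 - 2 * (C * (M * n)) - M * n = M * n * (M * n - 2 * C - 1) := by ring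
      have h3 : (0 : ℝ) ≤ M * n - 2 * C - 1 := by rw [hMr]; nlinarith
      have h4 : (0 : ℝ) ≤ M * n := by positivity
      nlinarith [mul_nonneg h4 h3]
    have q3 : (n : ℝ) ≤ M * n := by rw [hMr]; nlinarith
    linarith
  have hfin := h n
  have s4 : (C : ℝ) * f (C * n + C) ≤ C * f (E * n) := by gcongr
  have hf0 := h0 (E * n)
  have hEr : (C : ℝ) + 2 * C * C ≤ E := by
    rw [hE]; push_cast
    have : (0 : ℝ) ≤ 2 * C * M := by positivity
    linarith
  calc (b n : ℝ) ≤ C * f (E * n) + C * n + C * n := by nlinarith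
    _ ≤ C * f (E * n) + 2 * C * (C * f (E * n)) := by nlinarith
    _ = (C + 2 * C * C) * f (E * n) := by ring
    _ ≤ E * f (E * n) := by gcongr

theorem superadditiveClosure_zero (f : ℕ → ℝ) : superadditiveClosure f 0 = 0 := by
  unfold superadditiveClosure
  have : ∀ c : Composition 0, (c.blocks.map f).sum = 0 := by
    intro c
    have : c.blocks = [] := by
      rw [← List.length_eq_zero_iff]
      exact Nat.le_zero.1 c.length_le
    simp [this]
  simp [this]

theorem superadditiveClosure_nonneg {f : ℕ → ℝ} (h0 : ∀ n, 0 ≤ f n) (n : ℕ) :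
    0 ≤ superadditiveClosure f n := by
  rcases Nat.eq_zero_or_pos n with rfl | hn
  · rw [superadditiveClosure_zero]
  · exact (h0 n).trans (le_superadditiveClosure f hn)

theorem superadditiveClosure_mono {f : ℕ → ℝ} (h0 : ∀ n, 0 ≤ f n) :
    Monotone (superadditiveClosure f) := by
  intro a b hab
  rcases Nat.eq_zero_or_pos a with rfl | ha
  · rw [superadditiveClosure_zero]; exact superadditiveClosure_nonneg h0 b
  rcases hab.eq_or_lt with rfl | hlt
  · rfl
  have := isSuperadditive_superadditiveClosure f a (b - a) ha (by omega)
  rw [Nat.add_sub_cancel' hab] at this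
  linarith [superadditiveClosure_nonneg h0 (b - a)]

/-- Doubling the closure at one scale is bounded by its value at the next, so each of the `j` scales
contributes at most `E` times the top value. The power of two comes from the letters. -/
theorem dyadicSum_le_superadditiveClosure {f : ℕ → ℝ} (h0 : ∀ n, 0 ≤ f n) {c : ℕ → ℕ} {E : ℕ}
    (hE : 0 < E) (h : ∀ N, 0 < N → (c N : ℝ) ≤ E * f (E * N)) (j : ℕ) :
    (dyadicSum c j : ℝ) ≤ 2 ^ j + j * (E * superadditiveClosure f (E * 2 ^ j)) := by
  induction j with
  | zero => simp [dyadicSum]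
  | succ j ih =>
    have hpos : 0 < E * 2 ^ j := by positivity
    have e1 := isSuperadditive_superadditiveClosure f _ _ hpos hpos
    have e2 := le_superadditiveClosure f hpos
    have e3 := superadditiveClosure_nonneg h0 (E * 2 ^ j)
    have e4 := h (2 ^ j) (by positivity)
    have e5 : E * 2 ^ (j + 1) = E * 2 ^ j + E * 2 ^ j := by ring
    rw [dyadicSum, e5]
    set x := superadditiveClosure f (E * 2 ^ j)
    set y := superadditiveClosure f (E * 2 ^ j + E * 2 ^ j)
    have hEr : (0 : ℝ) ≤ E := E.cast_nonneg
    have e6 : (E : ℝ) * f (E * 2 ^ j) ≤ E * y := by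
      apply mul_le_mul_of_nonneg_left _ hEr; linarith
    have e7 : (j : ℝ) * (E * (x + x)) ≤ j * (E * y) := by gcongr
    push_cast
    have : (2 : ℝ) ^ (j + 1) = 2 * 2 ^ j := by ring
    rw [this]
    linarith

/-- The hypothesis gives `4 * f n ≤ f (2 * n)` for `n > 0`. A recursion step needs only `2 + 1 = 3`
times the previous value, so the bound reproduces itself. -/
theorem dyadicSum_le_of_div_superadditive {f : ℕ → ℝ}
    (hf : IsSuperadditive (fun n => f n / n)) {c : ℕ → ℕ} {E : ℕ} (hE : 0 < E)
    (h0 : ∀ n, 0 ≤ f n) (h : ∀ N, 0 < N → (c N : ℝ) ≤ E * f (E * N)) (j : ℕ) :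
    (dyadicSum c j : ℝ) ≤ 2 ^ j + E * f (E * 2 ^ j) := by
  induction j with
  | zero => simpa [dyadicSum] using mul_nonneg E.cast_nonneg (h0 _)
  | succ j ih =>
    have hpos : 0 < E * 2 ^ j := by positivity
    have e1 := hf _ _ hpos hpos
    have e4 := h (2 ^ j) (by positivity)
    have e5 : E * 2 ^ (j + 1) = E * 2 ^ j + E * 2 ^ j := by ring
    rw [dyadicSum, e5]
    have hEr : (0 : ℝ) ≤ E := E.cast_nonneg
    have e2 : 4 * f (E * 2 ^ j) ≤ f (E * 2 ^ j + E * 2 ^ j) := by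
      have hp : (0 : ℝ) < (E * 2 ^ j : ℕ) := by exact_mod_cast hpos
      beta_reduce at e1
      rw [Nat.cast_add] at e1
      rw [← add_div, div_le_div_iff₀ hp (by linarith)] at e1
      nlinarith
    have e3 : (E : ℝ) * (4 * f (E * 2 ^ j)) ≤ E * f (E * 2 ^ j + E * 2 ^ j) := by gcongr
    have e6 : 0 ≤ (E : ℝ) * f (E * 2 ^ j) := mul_nonneg hEr (h0 _)
    push_cast
    have : (2 : ℝ) ^ (j + 1) = 2 * 2 ^ j := by ring
    rw [this]
    linarith

end Asymptotics

/-! ### Comparison with the sum of the Dehn functions -/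

section Comparison

variable {G : Fin 4 → Type*} [∀ i, Group (G i)]

/-- The sum of the Dehn functions of four groups and a quadratic function. -/
noncomputable def sumDehn (P : ∀ i, FinitePresentation (G i)) : ℕ →o ℕ where
  toFun n := n ^ 2 + ∑ i, (P i).dehn n
  monotone' a b h := by
    have : ∀ i, (P i).dehn a ≤ (P i).dehn b := fun i => (P i).dehn_mono h
    exact add_le_add (Nat.pow_le_pow_left h 2) (Finset.sum_le_sum fun i _ => this i)

theorem sq_le_sumDehn (P : ∀ i, FinitePresentation (G i)) (n : ℕ) : n ^ 2 ≤ sumDehn P n :=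
  Nat.le_add_right _ _

theorem dehnDominated_sumDehn (P : ∀ i, FinitePresentation (G i)) (i : Fin 4) :
    DehnDominated (sumDehn P) (G i) := by
  refine ⟨P i, 1, fun n => ?_⟩
  rw [one_mul, one_mul]
  exact ((P i).dehn_mono n.le_succ).trans ((Finset.single_le_sum
    (f := fun i => (P i).dehn (n + 1)) (fun _ _ => Nat.zero_le _) (Finset.mem_univ i)).trans
    (Nat.le_add_left _ _))

/-- The retractions control the four Dehn functions and `hQ` controls the square. It serves for the
kernel in the lower bound and for the full product in the upper bound. -/
theorem exists_sumDehn_le (P : ∀ i, FinitePresentation (G i)) {Γ : Type*} [Group Γ]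
    (Q : FinitePresentation Γ) (s : ∀ i, G i →* Γ) (r : ∀ i, Γ →* G i)
    (hrs : ∀ i g, r i (s i g) = g) (hQ : ∃ C : ℕ, ∀ n, n ^ 2 ≤ C * Q.dehn (C * n)) :
    ∃ C : ℕ, ∀ n, sumDehn P n ≤ C * Q.dehn (C * n) + C * n := by
  obtain ⟨C, hC⟩ := hQ
  choose E hE using fun i => (P i).exists_dehn_le_of_retract Q (s i) (r i) (hrs i)
  refine ⟨C + ∑ i, E i, fun n => ?_⟩
  have h1 : n ^ 2 ≤ C * Q.dehn ((C + ∑ i, E i) * n) :=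
    (hC n).trans (Nat.mul_le_mul_left _ (Q.dehn_mono (Nat.mul_le_mul_right _ (by omega))))
  have h2 : ∀ i, (P i).dehn n ≤ E i * Q.dehn ((C + ∑ i, E i) * n) + E i * n := by
    intro i
    have hi : E i ≤ C + ∑ i, E i :=
      (Finset.single_le_sum (f := E) (fun _ _ => Nat.zero_le _) (Finset.mem_univ i)).trans
        (Nat.le_add_left _ _)
    exact (hE i n).trans (Nat.add_le_add_right (Nat.mul_le_mul_left _
      (Q.dehn_mono (Nat.mul_le_mul_right _ hi))) _)
  calc sumDehn P n = n ^ 2 + ∑ i, (P i).dehn n := rfl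
    _ ≤ C * Q.dehn ((C + ∑ i, E i) * n) +
        ∑ i, (E i * Q.dehn ((C + ∑ i, E i) * n) + E i * n) :=
      add_le_add h1 (Finset.sum_le_sum fun i _ => h2 i)
    _ ≤ _ := by
      rw [Finset.sum_add_distrib, ← Finset.sum_mul, ← Finset.sum_mul, add_mul, add_mul]
      have := Nat.zero_le (C * n)
      omega

/-- The Dehn function of the product is dominated by `sumDehn`. -/
theorem exists_dehn_pi_le (P : ∀ i, FinitePresentation (G i)) (Q : FinitePresentation (∀ i, G i)) :
    ∃ C : ℕ, ∀ n, Q.dehn n ≤ C * sumDehn P (C * (n + 1)) + C * n := by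
  have hd := dehnDominated_sumDehn P
  obtain ⟨R, C, hC⟩ := ((hd 0).prod (sumDehn P).monotone (sq_le_sumDehn P) (hd 1)).prod
    (sumDehn P).monotone (sq_le_sumDehn P)
    ((hd 2).prod (sumDehn P).monotone (sq_le_sumDehn P) (hd 3))
  -- The retract estimate is applied to this isomorphism with the iterated binary product.
  let s : (∀ i, G i) →* (G 0 × G 1) × (G 2 × G 3) :=
    { toFun := fun g => ((g 0, g 1), (g 2, g 3))
      map_one' := rfl
      map_mul' := fun _ _ => rfl }
  let r : (G 0 × G 1) × (G 2 × G 3) →* (∀ i, G i) :=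
    { toFun := fun g i => match i with
        | 0 => g.1.1
        | 1 => g.1.2
        | 2 => g.2.1
        | 3 => g.2.2
      map_one' := by funext i; fin_cases i <;> rfl
      map_mul' := by intro a b; funext i; fin_cases i <;> rfl }
  obtain ⟨D, hD⟩ := Q.exists_dehn_le_of_retract R s r
    (fun g => by funext i; fin_cases i <;> rfl)
  refine ⟨D * C + C * (D + 1) + D, fun n => (hD n).trans ?_⟩
  have h1 : R.dehn (D * n) ≤ C * sumDehn P ((D * C + C * (D + 1) + D) * (n + 1)) := by
    refine (hC _).trans (Nat.mul_le_mul_left _ ((sumDehn P).monotone ?_))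
    calc C * (D * n + 1) ≤ C * ((D + 1) * (n + 1)) := Nat.mul_le_mul_left _ (by nlinarith)
      _ = C * (D + 1) * (n + 1) := by ring
      _ ≤ _ := Nat.mul_le_mul_right _ (by omega)
  have h2 : D * R.dehn (D * n) ≤ (D * C + C * (D + 1) + D) *
      sumDehn P ((D * C + C * (D + 1) + D) * (n + 1)) := by
    calc D * R.dehn (D * n) ≤ D * (C * sumDehn P ((D * C + C * (D + 1) + D) * (n + 1))) :=
          Nat.mul_le_mul_left _ h1
      _ = D * C * sumDehn P ((D * C + C * (D + 1) + D) * (n + 1)) := by ring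
      _ ≤ _ := Nat.mul_le_mul_right _ (by omega)
  have h3 : D * n ≤ (D * C + C * (D + 1) + D) * n := Nat.mul_le_mul_right _ (by omega)
  omega

theorem AsympLE.of_sumDehn {a b H : ℕ → ℕ} (hb : Monotone b) {C E : ℕ}
    (h : ∀ n, a n ≤ C * H (C * (n + 1)) + C * n) (hH : ∀ n, H n ≤ E * b (E * n) + E * n) :
    AsympLE (fun n => (a n : ℝ)) (fun n => (b n : ℝ)) := by
  refine ⟨C * E + E * C + C * E * C + C + 1, by omega, fun n => ?_⟩
  set M := C * E + E * C + C * E * C + C + 1 with hM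
  have h1 : b (E * (C * (n + 1))) ≤ b (M * n + M) := hb (by
    rw [← mul_assoc, show M * n + M = M * (n + 1) by ring]
    exact Nat.mul_le_mul_right _ (by omega))
  have h2 : a n ≤ M * b (M * n + M) + M * n + M := by
    calc a n ≤ C * H (C * (n + 1)) + C * n := h n
      _ ≤ C * (E * b (M * n + M) + E * (C * (n + 1))) + C * n := by
        gcongr
        exact (hH _).trans (Nat.add_le_add_right (Nat.mul_le_mul_left _ h1) _)
      _ = C * E * b (M * n + M) + (C * E * C + C) * n + C * E * C := by ring
      _ ≤ M * b (M * n + M) + M * n + M := by gcongr <;> omega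
  beta_reduce
  exact_mod_cast h2

/-- Passing from powers of two to all arguments. -/
theorem AsympLE.of_two_pow {a q : ℕ → ℕ} (hq : Monotone q) {C : ℕ}
    (h : ∀ n, a n ≤ C * q (C * n) + C * n) {g : ℕ → ℝ} (hg : Monotone g) (h0 : ∀ n, 0 ≤ g n)
    {E : ℕ}
    (hqg : ∀ j N : ℕ, 0 < N → 2 ^ j ≤ 2 * N → (q (2 ^ j) : ℝ) ≤ 2 ^ j + 1 + E * g (E * N)) :
    AsympLE (fun n => (a n : ℝ)) g := by
  refine ⟨C * E + 2 * C * C + 4 * C + E + 1, by omega, fun n => ?_⟩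
  set M := C * E + 2 * C * C + 4 * C + E + 1 with hM
  have hj1 : C * n ≤ 2 ^ (Nat.log 2 (C * n + 1) + 1) :=
    (Nat.lt_pow_succ_log_self (by norm_num) (C * n + 1)).le.trans' (by omega)
  have hj2 : 2 ^ (Nat.log 2 (C * n + 1) + 1) ≤ 2 * (C * n + 1) := by
    rw [pow_succ, mul_comm]
    exact Nat.mul_le_mul_left _ (Nat.pow_log_le_self 2 (by omega))
  set j := Nat.log 2 (C * n + 1) + 1
  have e1 := hqg j (C * n + 1) (by omega) hj2
  have e2 : g (E * (C * n + 1)) ≤ g (M * n + M) := hg (by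
    rw [mul_add, ← mul_assoc, mul_one]
    exact add_le_add (Nat.mul_le_mul_right _ (by rw [mul_comm E C]; omega)) (by omega))
  have e3 : (a n : ℝ) ≤ C * q (2 ^ j) + C * n := by
    have : a n ≤ C * q (2 ^ j) + C * n :=
      (h n).trans (Nat.add_le_add_right (Nat.mul_le_mul_left _ (hq hj1)) _)
    exact_mod_cast this
  have hj2' : (2 : ℝ) ^ j ≤ 2 * (C * n + 1) := by exact_mod_cast hj2
  have hCr : (0 : ℝ) ≤ C := C.cast_nonneg
  have hEr : (0 : ℝ) ≤ E := E.cast_nonneg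
  have hn : (0 : ℝ) ≤ n := n.cast_nonneg
  have e4 : (q (2 ^ j) : ℝ) ≤ 2 * (C * n + 1) + 1 + E * g (M * n + M) :=
    e1.trans (by gcongr)
  have e5 : (C : ℝ) * q (2 ^ j) ≤ C * (2 * (C * n + 1) + 1 + E * g (M * n + M)) := by gcongr
  have hMr : (M : ℝ) = C * E + 2 * C * C + 4 * C + E + 1 := by rw [hM]; push_cast; ring
  have e6 : (C * E : ℝ) * g (M * n + M) ≤ M * g (M * n + M) := by
    refine mul_le_mul_of_nonneg_right ?_ (h0 _)
    rw [hMr]; nlinarith [mul_nonneg hCr hCr]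
  have e7 : (2 * C * C + C : ℝ) * n ≤ M * n := by
    refine mul_le_mul_of_nonneg_right ?_ hn
    rw [hMr]; nlinarith [mul_nonneg hCr hEr]
  have e8 : (3 * C : ℝ) ≤ M := by
    rw [hMr]; nlinarith [mul_nonneg hCr hEr, mul_nonneg hCr hCr]
  beta_reduce
  linarith

theorem monotone_superadditiveClosure_mul_log {f : ℕ → ℝ} (h0 : ∀ n, 0 ≤ f n) :
    Monotone fun n : ℕ => superadditiveClosure f n * Real.log n := by
  intro a b hab
  have h1 := superadditiveClosure_mono h0 hab
  have h2 : Real.log a ≤ Real.log b := by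
    rcases Nat.eq_zero_or_pos a with rfl | ha
    · simpa using Real.log_natCast_nonneg b
    · exact Real.log_le_log (by exact_mod_cast ha) (by exact_mod_cast hab)
  exact mul_le_mul h1 h2 (Real.log_natCast_nonneg a) (superadditiveClosure_nonneg h0 b)

theorem superadditiveClosure_mul_log_nonneg {f : ℕ → ℝ} (h0 : ∀ n, 0 ≤ f n) (n : ℕ) :
    0 ≤ superadditiveClosure f n * Real.log n :=
  mul_nonneg (superadditiveClosure_nonneg h0 n) (Real.log_natCast_nonneg n)

theorem le_two_mul_log_of_two_pow_le {j N : ℕ} (h : 2 ^ j ≤ N) : (j : ℝ) ≤ 2 * Real.log N := by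
  have h1 : (j : ℝ) * Real.log 2 ≤ Real.log N := by
    rw [← Real.log_pow]
    exact Real.log_le_log (by positivity) (by exact_mod_cast h)
  have h2 := Real.log_two_gt_d9
  have h3 : (0 : ℝ) ≤ j := j.cast_nonneg
  nlinarith

theorem asympLE_superadditiveClosure_mul_log {f : ℕ → ℝ} (hf : Monotone f) (h0 : ∀ n, 0 ≤ f n) :
    AsympLE f fun n => superadditiveClosure f n * Real.log n := by
  -- Since `3` exceeds `e`, the logarithm at `3 * n + 3` is at least `1`.
  refine ⟨3, by norm_num, fun n => ?_⟩
  have h1 : f n ≤ superadditiveClosure f (3 * n + 3) :=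
    (hf (by omega)).trans (le_superadditiveClosure f (by omega))
  have h2 : (1 : ℝ) ≤ Real.log (3 * n + 3 : ℕ) := by
    rw [Real.le_log_iff_exp_le (by positivity)]
    have := Real.exp_one_lt_d9
    push_cast
    have hn : (0 : ℝ) ≤ n := n.cast_nonneg
    linarith
  have h3 := superadditiveClosure_nonneg h0 (3 * n + 3)
  have hn : (0 : ℝ) ≤ n := n.cast_nonneg
  have h4 : superadditiveClosure f (3 * n + 3) ≤
      superadditiveClosure f (3 * n + 3) * Real.log (3 * n + 3 : ℕ) :=
    le_mul_of_one_le_right h3 h2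
  push_cast at h4 ⊢
  linarith

end Comparison

/-! ### Bounds for the Dehn function of the kernel -/

namespace BiSplitting

variable {G : Fin 4 → Type*} [∀ i, Group (G i)] {A B : Type*} [CommGroup A] [CommGroup B]
  (D : BiSplitting G A B) (P : ∀ i, FinitePresentation (G i))

/-- Each factor embeds into the kernel as a retract. -/
theorem exists_retract (i : Fin 4) :
    ∃ s : G i →* D.kernel, ∀ g, (Pi.evalMonoidHom G i).comp D.kernel.subtype (s g) = g := by
  have h : ∀ i : Fin 4, ∃ j k : Fin 4, i ≠ j ∧ i ≠ k ∧ j ≠ k := by decide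
  obtain ⟨j, k, hij, hik, hjk⟩ := h i
  refine ⟨D.twist i j k hij hik hjk, fun g => ?_⟩
  rw [MonoidHom.comp_apply, Subgroup.coe_subtype, Pi.evalMonoidHom_apply, coe_twist]
  simp [Pi.mulSingle_eq_of_ne hij, Pi.mulSingle_eq_of_ne hik]

theorem isFinitelyPresented_kernel (hG : ∀ i, Group.IsFinitelyPresented (G i)) :
    Group.IsFinitelyPresented D.kernel := by
  have P := fun i => (FinitePresentation.nonempty_of_isFinitelyPresented (hG i)).some
  obtain ⟨Q, -⟩ := D.exists_presentation (sq_le_sumDehn P) (dehnDominated_sumDehn P)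
  exact Q.isFinitelyPresented

include D P in
theorem dehn_pi_asympLE_dehn_kernel (R : FinitePresentation (∀ i, G i))
    (Q : FinitePresentation D.kernel) (hQ : ∃ C : ℕ, ∀ n, n ^ 2 ≤ C * Q.dehn (C * n)) :
    AsympLE (fun n => (R.dehn n : ℝ)) (fun n => (Q.dehn n : ℝ)) := by
  choose s hs using D.exists_retract
  obtain ⟨E, hE⟩ := exists_sumDehn_le P Q s _ hs hQ
  obtain ⟨C, hC⟩ := exists_dehn_pi_le P R
  exact AsympLE.of_sumDehn Q.dehn_mono hC hE

/-- The upper bounds for the Dehn function of the kernel. -/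
theorem dehn_kernel_asympLE (hG : ∀ i, Group.IsFinitelyPresented (G i))
    (R : FinitePresentation (∀ i, G i)) (Q : FinitePresentation D.kernel)
    (hR : ∃ C : ℕ, ∀ n, n ^ 2 ≤ C * R.dehn (C * n)) {f : ℕ → ℝ} (hf : Monotone f)
    (h0 : ∀ n, 0 ≤ f n) (hRf : AsympLE (fun n => (R.dehn n : ℝ)) f) :
    AsympLE (fun n => (Q.dehn n : ℝ)) (fun n => superadditiveClosure f n * Real.log n) ∧
    (IsSuperadditive (fun n => f n / n) → AsympLE (fun n => (Q.dehn n : ℝ)) f) := by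
  have P := fun i => (FinitePresentation.nonempty_of_isFinitelyPresented (hG i)).some
  obtain ⟨Q', C, hC⟩ := D.exists_presentation (sq_le_sumDehn P) (dehnDominated_sumDehn P)
  obtain ⟨M, hM⟩ := Q.exists_dehn_le_of_retract Q' (MonoidHom.id _) (MonoidHom.id _) fun _ => rfl
  obtain ⟨E₁, hE₁⟩ := exists_sumDehn_le P R (MonoidHom.mulSingle G) (Pi.evalMonoidHom G)
    (fun i g => by simp) hR
  obtain ⟨E₂, -, hE₂⟩ := (AsympLE.of_nat R.dehn_mono hE₁).trans hRf hf h0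
  obtain ⟨E₃, hE₃⟩ := exists_le_mul_of_sq_le hf h0 (sq_le_sumDehn P) hE₂
  -- For `N > 0` the shift is absorbed by `C * (N + 1) ≤ (2 * C + 1) * N`, so each dyadic scale
  -- costs a multiple of `f` with no linear remainder.
  obtain ⟨E, hE, hcE⟩ : ∃ E : ℕ, 0 < E ∧ ∀ N, 0 < N →
      ((C * sumDehn P (C * (N + 1)) : ℕ) : ℝ) ≤ E * f (E * N) := by
    refine ⟨C * E₃ + E₃ * (2 * C + 1) + 1, by omega, fun N hN => ?_⟩
    have e1 : sumDehn P (C * (N + 1)) ≤ sumDehn P ((2 * C + 1) * N) :=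
      (sumDehn P).monotone (by nlinarith)
    have e2 := hE₃ ((2 * C + 1) * N) (by positivity)
    have e3 : f (E₃ * ((2 * C + 1) * N)) ≤ f ((C * E₃ + E₃ * (2 * C + 1) + 1) * N) := hf (by
      rw [← mul_assoc]; exact Nat.mul_le_mul_right _ (by omega))
    have e4 : (sumDehn P (C * (N + 1)) : ℝ) ≤
        E₃ * f ((C * E₃ + E₃ * (2 * C + 1) + 1) * N) :=
      (Nat.cast_le.2 e1).trans (e2.trans (by gcongr))
    push_cast
    calc (C : ℝ) * sumDehn P (C * (N + 1))
        ≤ C * (E₃ * f ((C * E₃ + E₃ * (2 * C + 1) + 1) * N)) := by gcongr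
      _ = (C * E₃) * f ((C * E₃ + E₃ * (2 * C + 1) + 1) * N) := by ring
      _ ≤ _ := by
        refine mul_le_mul_of_nonneg_right ?_ (h0 _)
        have : (0 : ℝ) ≤ E₃ * (2 * C + 1) := by positivity
        linarith
  have hQ' : ∀ j, (Q'.dehn (2 ^ j) : ℝ) ≤
      dyadicSum (fun N => C * sumDehn P (C * (N + 1))) j + 1 := fun j => by exact_mod_cast hC j
  have hEr : (1 : ℝ) ≤ E := by exact_mod_cast hE
  -- In the argument, the factor `2` allows for `2 ^ j ≤ 2 * N`; in front of the closure it comes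
  -- from `j ≤ 2 * log`.
  refine ⟨AsympLE.of_two_pow (E := 2 * E) Q'.dehn_mono hM
    (monotone_superadditiveClosure_mul_log h0) (superadditiveClosure_mul_log_nonneg h0) ?_,
    fun hsup => AsympLE.of_two_pow (E := 2 * E) Q'.dehn_mono hM hf h0 ?_⟩
  · intro j N hN hj
    have e1 := dyadicSum_le_superadditiveClosure h0 hE hcE j
    have hle : 2 ^ j ≤ 2 * E * N := hj.trans (Nat.mul_le_mul_right _ (by omega))
    have e2 := le_two_mul_log_of_two_pow_le hle
    have e3 : superadditiveClosure f (E * 2 ^ j) ≤ superadditiveClosure f (2 * E * N) :=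
      superadditiveClosure_mono h0 (by nlinarith)
    have e4 : (j : ℝ) * (E * superadditiveClosure f (E * 2 ^ j)) ≤
        2 * Real.log (2 * E * N : ℕ) * (E * superadditiveClosure f (2 * E * N)) := by
      have := superadditiveClosure_nonneg h0 (E * 2 ^ j)
      gcongr
    have e5 := hQ' j
    have e6 : 2 * Real.log (2 * E * N : ℕ) * (E * superadditiveClosure f (2 * E * N)) =
      (2 * E : ℕ) * (superadditiveClosure f (2 * E * N) * Real.log (2 * E * N : ℕ)) := by
      push_cast; ring
    linarith
  · intro j N hN hj
    have e1 := dyadicSum_le_of_div_superadditive hsup hE h0 hcE j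
    have e3 : f (E * 2 ^ j) ≤ f (2 * E * N) := hf (by nlinarith)
    have e5 := hQ' j
    have e6 : (E : ℝ) * f (E * 2 ^ j) ≤ (2 * E : ℕ) * f (2 * E * N) := by
      push_cast
      exact mul_le_mul (by linarith) e3 (h0 _) (by positivity)
    linarith

end BiSplitting

/-! ### From splittings over `A` and `B` to coordinate maps -/

section Splitting

variable {G : Fin 4 → Type*} [∀ i, Group (G i)] {m : ℕ}
  {φ : ∀ i, G i →* Multiplicative (Fin m → ℤ)} {A B : AddSubgroup (Fin m → ℤ)}

/-- The projection onto a direct summand of `ℤᵐ`. -/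
theorem exists_projection (hAB : IsCompl A B) :
    ∃ p : Multiplicative (Fin m → ℤ) →* Multiplicative A,
      (∀ a : A, p (Multiplicative.ofAdd (a : Fin m → ℤ)) = Multiplicative.ofAdd a) ∧
      (∀ b : B, p (Multiplicative.ofAdd (b : Fin m → ℤ)) = 1) := by
  have h : IsCompl (AddSubgroup.toIntSubmodule A) (AddSubgroup.toIntSubmodule B) :=
    AddSubgroup.toIntSubmodule.isCompl hAB
  let q := Submodule.projectionOnto _ _ h
  refine ⟨AddMonoidHom.toMultiplicative q.toAddMonoidHom, fun a => ?_, fun b => ?_⟩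
  · exact congrArg Multiplicative.ofAdd (Submodule.projectionOnto_apply_left h a)
  · exact congrArg Multiplicative.ofAdd (Submodule.projectionOnto_apply_right h b)

/-- The splitting data of the theorem in terms of the two projections. -/
theorem exists_biSplitting (hAB : IsCompl A B) (hsplit : ∀ i, PSplits (φ i) A B) :
    ∃ D : BiSplitting G (Multiplicative A) (Multiplicative B), D.kernel = (sumHom φ).ker := by
  obtain ⟨p, hpA, hpB⟩ := exists_projection hAB
  obtain ⟨q, hqB, hqA⟩ := exists_projection hAB.symm
  choose s hs using fun i => (hsplit i).1
  choose t ht using fun i => (hsplit i).2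
  let D : BiSplitting G (Multiplicative A) (Multiplicative B) :=
    { α := fun i => p.comp (φ i)
      β := fun i => q.comp (φ i)
      s := s
      t := t
      α_s := fun i a => by
        have := hs i a.toAdd
        rw [ofAdd_toAdd] at this
        rw [MonoidHom.comp_apply, this, hpA, ofAdd_toAdd]
      β_s := fun i a => by
        have := hs i a.toAdd
        rw [ofAdd_toAdd] at this
        rw [MonoidHom.comp_apply, this, hqA]
      α_t := fun i b => by
        have := ht i b.toAdd
        rw [ofAdd_toAdd] at this
        rw [MonoidHom.comp_apply, this, hpB]
      β_t := fun i b => by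
        have := ht i b.toAdd
        rw [ofAdd_toAdd] at this
        rw [MonoidHom.comp_apply, this, hqB, ofAdd_toAdd] }
  have hsum : ∀ g, sumHom φ g = ∏ i, φ i (g i) := fun g => by
    change Multiplicative.ofAdd _ = _
    rw [ofAdd_sum]; rfl
  refine ⟨D, Subgroup.ext fun g => ?_⟩
  rw [D.mem_kernel, D.totalα_apply, D.totalβ_apply, MonoidHom.mem_ker, hsum]
  change ∏ i, p (φ i (g i)) = 1 ∧ ∏ i, q (φ i (g i)) = 1 ↔ _
  rw [← map_prod, ← map_prod]
  generalize ∏ i, φ i (g i) = v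
  constructor
  · rintro ⟨h1, h2⟩
    obtain ⟨a, ha, b, hb, hab⟩ := AddSubgroup.mem_sup.1
      (show v.toAdd ∈ A ⊔ B by rw [hAB.sup_eq_top]; trivial)
    have hv : v = Multiplicative.ofAdd a * Multiplicative.ofAdd b := by
      rw [← ofAdd_add, hab, ofAdd_toAdd]
    rw [hv, map_mul] at h1 h2
    rw [hpA ⟨a, ha⟩, hpB ⟨b, hb⟩, mul_one, ofAdd_eq_one] at h1
    rw [hqA ⟨a, ha⟩, hqB ⟨b, hb⟩, one_mul, ofAdd_eq_one] at h2
    have h1' : a = 0 := congrArg Subtype.val h1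
    have h2' : b = 0 := congrArg Subtype.val h2
    rw [hv, h1', h2']; simp
  · rintro rfl; simp

end Splitting

/-! ### The copy of `ℤ²` and the conclusion -/

/-- A group mapping to the product of four groups, whose image contains a suitable copy of `ℤ²`, has
at least quadratic Dehn function. -/
theorem exists_sq_le_dehn_of_pi {G : Fin 4 → Type*} [∀ i, Group (G i)] {Γ : Type*} [Group Γ]
    (Q : FinitePresentation Γ) (ι : Γ →* ∀ i, G i) (hι : Function.Injective ι)
    (χ : ∀ i, G i →* Multiplicative ℤ) (x : ∀ i, G i) {c : ℤ} (hc : c ≠ 0)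
    (hχ : ∀ i, χ i (x i) = Multiplicative.ofAdd c)
    (hu : Pi.mulSingle 0 (x 0) * Pi.mulSingle 1 (x 1)⁻¹ ∈ ι.range)
    (hv : Pi.mulSingle 2 (x 2) * Pi.mulSingle 3 (x 3)⁻¹ ∈ ι.range) :
    ∃ C : ℕ, ∀ n, n ^ 2 ≤ C * Q.dehn (C * n) := by
  obtain ⟨u, hu⟩ := hu
  obtain ⟨v, hv⟩ := hv
  -- The two elements have disjoint supports `{0, 1}` and `{2, 3}`, hence commute; the characters
  -- read off coordinates `0` and `2`.
  refine Q.exists_sq_le_dehn (((χ 0).comp (Pi.evalMonoidHom G 0)).comp ι)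
    (((χ 2).comp (Pi.evalMonoidHom G 2)).comp ι) (u := u) (v := v) (hι ?_) hc ?_ ?_ ?_ ?_
  · rw [map_mul, map_mul, hu, hv]
    have h : ∀ (i j : Fin 4) (hij : i ≠ j) (a : G i) (b : G j),
        Commute (Pi.mulSingle i a : ∀ i, G i) (Pi.mulSingle j b) :=
      fun i j hij a b => Pi.mulSingle_commute hij a b
    exact ((h 0 2 (by decide) _ _).mul_right (h 0 3 (by decide) _ _)).mul_left
      ((h 1 2 (by decide) _ _).mul_right (h 1 3 (by decide) _ _))
  · simp [hu, hχ]
  · simp [hv]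
  · simp [hu]
  · simp [hv, hχ]

theorem mainTheorem2 {G : Fin 4 → Type*} [∀ i, Group (G i)]
    (hG : ∀ i, Group.IsFinitelyPresented (G i)) (m : ℕ)
    (φ : ∀ i, G i →* Multiplicative (Fin m → ℤ)) (hφ : ∀ i, Function.Surjective (φ i))
    (A B : AddSubgroup (Fin m → ℤ)) (hAB : IsCompl A B) (hsplit : ∀ i, PSplits (φ i) A B) :
    Group.IsFinitelyPresented (sumHom φ).ker ∧
    -- `f` is any function in the equivalence class of the Dehn function of the product, for example
    -- the Dehn function of the finite presentation `P` itself
    ∀ (P : FinitePresentation (∀ i, G i)) (Q : FinitePresentation (sumHom φ).ker) (f : ℕ → ℝ),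
      Monotone f → (∀ n, 0 ≤ f n) → AsympEq f (fun n => (P.dehn n : ℝ)) →
        AsympLE f (fun n => (Q.dehn n : ℝ)) ∧
        AsympLE (fun n => (Q.dehn n : ℝ)) (fun n => superadditiveClosure f n * Real.log n) ∧
        (IsSuperadditive (fun n => f n / n) → AsympEq f (fun n => (Q.dehn n : ℝ))) := by
  obtain ⟨D, hD⟩ := exists_biSplitting hAB hsplit
  -- A non-zero vector lies in the image of one of the two families of sections.
  have hdata : m ≠ 0 → ∃ (χ : ∀ i, G i →* Multiplicative ℤ) (x : ∀ i, G i) (c : ℤ), c ≠ 0 ∧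
      (∀ i, χ i (x i) = Multiplicative.ofAdd c) ∧
      Pi.mulSingle 0 (x 0) * Pi.mulSingle 1 (x 1)⁻¹ ∈ D.kernel ∧
      Pi.mulSingle 2 (x 2) * Pi.mulSingle 3 (x 3)⁻¹ ∈ D.kernel := by
    intro hm
    have key : ∀ S : AddSubgroup (Fin m → ℤ), S ≠ ⊥ →
        ∃ (a : S) (ℓ : Multiplicative S →* Multiplicative ℤ) (c : ℤ), c ≠ 0 ∧
          ℓ (Multiplicative.ofAdd a) = Multiplicative.ofAdd c := by
      intro S hS
      obtain ⟨a, ha⟩ := AddSubgroup.ne_bot_iff_exists_ne_zero.1 hS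
      obtain ⟨e, he⟩ := Function.ne_iff.1 (fun h => ha (Subtype.ext h) : a.1 ≠ 0)
      exact ⟨a, AddMonoidHom.toMultiplicative
        ((Pi.evalAddMonoidHom (fun _ : Fin m => ℤ) e).comp S.subtype), a.1 e, he, rfl⟩
    by_cases hA : A = ⊥
    · have hB : B ≠ ⊥ := by
        rintro rfl
        have := hAB.sup_eq_top
        rw [hA, sup_bot_eq] at this
        have h1 : (fun _ => 1 : Fin m → ℤ) ∈ (⊥ : AddSubgroup (Fin m → ℤ)) := by
          rw [this]; trivial
        exact one_ne_zero (congrFun (AddSubgroup.mem_bot.1 h1) ⟨0, Nat.pos_of_ne_zero hm⟩)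
      obtain ⟨b, ℓ, c, hc, hℓ⟩ := key B hB
      refine ⟨fun i => ℓ.comp (D.β i), fun i => D.t i (Multiplicative.ofAdd b), c, hc,
        fun i => by rw [MonoidHom.comp_apply, D.β_t, hℓ], ?_, ?_⟩ <;>
      · rw [D.mem_kernel]
        simp [D.totalα_mulSingle, D.totalβ_mulSingle, D.α_t, D.β_t]
    · obtain ⟨a, ℓ, c, hc, hℓ⟩ := key A hA
      refine ⟨fun i => ℓ.comp (D.α i), fun i => D.s i (Multiplicative.ofAdd a), c, hc,
        fun i => by rw [MonoidHom.comp_apply, D.α_s, hℓ], ?_, ?_⟩ <;>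
      · rw [D.mem_kernel]
        simp [D.totalα_mulSingle, D.totalβ_mulSingle, D.α_s, D.β_s]
  have htop : m = 0 → D.kernel = ⊤ := by
    rintro rfl
    rw [hD, Subgroup.eq_top_iff']
    exact fun g => Subsingleton.elim _ _
  rw [← hD]
  refine ⟨D.isFinitelyPresented_kernel hG, fun P Q f hf h0 hfP => ?_⟩
  have hQmono : Monotone fun n => (Q.dehn n : ℝ) := fun a b h => Nat.cast_le.2 (Q.dehn_mono h)
  have hQ0 : ∀ n, (0 : ℝ) ≤ Q.dehn n := fun n => Nat.cast_nonneg _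
  -- For `m = 0` the kernel is the whole product, whose Dehn function may be less than quadratic;
  -- the claims then follow from invariance under isomorphism.
  by_cases hm : m = 0
  · let e : (∀ i, G i) →* D.kernel :=
      (MonoidHom.id (∀ i, G i)).codRestrict D.kernel fun g => by rw [htop hm]; trivial
    obtain ⟨C₁, h₁⟩ := P.exists_dehn_le_of_retract Q e D.kernel.subtype fun _ => rfl
    obtain ⟨C₂, h₂⟩ := Q.exists_dehn_le_of_retract P D.kernel.subtype e fun _ => rfl
    have hfQ := hfP.1.trans (AsympLE.of_nat Q.dehn_mono h₁) hQmono hQ0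
    have hQf := (AsympLE.of_nat P.dehn_mono h₂).trans hfP.2 hf h0
    exact ⟨hfQ, hQf.trans (asympLE_superadditiveClosure_mul_log hf h0)
      (monotone_superadditiveClosure_mul_log h0) (superadditiveClosure_mul_log_nonneg h0),
      fun _ => ⟨hfQ, hQf⟩⟩
  · obtain ⟨χ, x, c, hc, hχ, hu, hv⟩ := hdata hm
    have hP2 := exists_sq_le_dehn_of_pi P (MonoidHom.id _) Function.injective_id χ x hc hχ
      ⟨_, rfl⟩ ⟨_, rfl⟩
    have hQ2 := exists_sq_le_dehn_of_pi Q D.kernel.subtype D.kernel.subtype_injective χ x hc hχ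
      (by rwa [Subgroup.range_subtype]) (by rwa [Subgroup.range_subtype])
    have hfQ := hfP.1.trans (D.dehn_pi_asympLE_dehn_kernel
      (fun i => (FinitePresentation.nonempty_of_isFinitelyPresented (hG i)).some) P Q hQ2) hQmono hQ0
    obtain ⟨hup, hsup⟩ := D.dehn_kernel_asympLE hG P Q hP2 hf h0 hfP.2
    exact ⟨hfQ, hup, fun h => ⟨hfQ, hsup h⟩⟩
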